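/- **Model.** Time is slotted, $t_0,t_1,t_2,\dots$; slot $k$ lasts from $t_k$ to $t_{k+1}$. Tasks are generated by a discrete-time Markovian arrival process (D-MAP) $(D_0,D_1)$ with phases $\{1,\dots,m\}$: $D_0,D_1$ are nonnegative and nonzero, $D=D_0+D_1$ is stochastic, and $(D_0)_{ij}$ (resp. $(D_1)_{ij}$) is the probability of a phase change from $i$ to $j$ in a slot without (resp. with) a generated task; the average arrival rate is positive, i.e. $\pi D_1\mathbf e>0$ for every stationary distribution $\pi$ of $D$. Transmission times, computation times and vacation durations are mutually independent and discrete phase-type distributed on $\{1,2,\dots\}$ with representations $(\beta_1,S_1)$, $(\beta_2,S_2)$, $(v,V)$ (initial probability vector; substochastic matrix $T$ with $I-T$ nonsingular; exit vector $T^0=\mathbf e-T\mathbf e$). Queues 1 and 2 are FIFO single-server queues with capacities $1\le N_1<N_2<\infty$ (task in service included). A task generated in a slot enters queue 1 at the end of the slot if queue 1 holds fewer than $N_1$ tasks or a transmission completes in that slot; otherwise it is rejected. A transmitted task moves to queue 2, whose server works whenever queue 2 is nonempty; a task leaves the system when its computation completes. Whenever a transmission completes, a vacation expires, or a task enters an empty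 queue 1, server 1 becomes idle if queue 1 is then empty, starts a transmission if queue 1 is nonempty and queue 2 is not full, and starts a vacation if queue 1 is nonempty and queue 2 is full (queue lengths at the end of the slot). Let $\Xi$ be the resulting Markov chain of the states $(i_1,i_2,\varphi)$ at the times $t_k$, where $i_1,i_2$ are the queue lengths and $\varphi$ collects the D-MAP phase, the transmission or vacation phase of server 1 (if $i_1\ge1$) and the computation phase of server 2 (if $i_2\ge1$). Let $P$ be its transition matrix, let $x$ be a stationary distribution ($x\ge0$, $xP=x$, $x\mathbf e=1$), and let the system start from $x$. Let $T$ be the delay, in slots, of the task that enters queue 1 in a given slot $k$: the time from $t_{k+1}$ until its computation completes. All probabilities of events about $T$ are conditional on the event that a task does enter queue 1 in slot $k$. Put $\bar W_n=\mathsf P\{T\le n\}$, $PW_n=\mathsf P\{T=n\}$, $W_n=\mathsf P\{T>n\}$. Let $\hat P$ be the part of $P$ that belongs to transitions in which a task enters queue 1, and let $\tilde x^{(0)}=z=x\hat P/(x\hat P\mathbf e)$. Let $\tilde P$ be the transition matrix of the same system without new arrivals, i.e. $P$ with $D_0$ replaced by $I$ and $D_1$ by $0$, and let $\tilde x^{(n)}=z\tilde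 P^{\,n}$. Let $\tilde x^{(n)}_{00}$ be the part of $\tilde x^{(n)}$ on the states with $i_1=i_2=0$. **Proposition.** For every slot $k$, a task enters queue 1 in slot $k$ with positive probability, $\bar W_0=0$, and for all $n\ge1$ $$\bar W_n=\tilde x^{(n)}_{00}\,\mathbf e,\qquad PW_n=\bar W_n-\bar W_{n-1},\qquad W_n=1-\bar W_n .$$ -/

import Mathlib

namespace TandemQueue

open scoped Matrix

/-- A representation `(α, T)` of order `n` of a discrete phase-type distribution: the law of the
absorption time of the Markov chain on `n` transient phases and one absorbing state which starts
from `α` and moves among the transient phases according to `T`. -/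
structure DPH (n : ℕ) where
  init : Fin n → ℝ
  trans : Matrix (Fin n) (Fin n) ℝ

/-- The vector `T⁰ = e - T e` of absorption probabilities. -/
def DPH.exit {n : ℕ} (F : DPH n) (j : Fin n) : ℝ := 1 - ∑ j', F.trans j j'

/-- `(α, T)` represents a distribution on `{1, 2, …}`: `α` is a probability vector on the transient
phases, `T` is substochastic and `I - T` is nonsingular. -/
structure DPH.IsValid {n : ℕ} (F : DPH n) : Prop where
  init_nonneg : ∀ j, 0 ≤ F.init j
  init_sum : ∑ j, F.init j = 1
  trans_nonneg : ∀ i j, 0 ≤ F.trans i j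
  trans_sum : ∀ i, ∑ j, F.trans i j ≤ 1
  nonsing : IsUnit (1 - F.trans)

/-- `D₀, D₁` are the parameters of a discrete-time Markovian arrival process with positive average
arrival rate `π D₁ e`, where `π` is stationary for `D₀ + D₁`. -/
structure IsDMAP {m : ℕ} (D₀ D₁ : Matrix (Fin m) (Fin m) ℝ) : Prop where
  nonneg₀ : ∀ i j, 0 ≤ D₀ i j
  nonneg₁ : ∀ i j, 0 ≤ D₁ i j
  exists_pos₀ : ∃ i j, 0 < D₀ i j
  exists_pos₁ : ∃ i j, 0 < D₁ i j
  row_sum : ∀ i, ∑ j, (D₀ + D₁) i j = 1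
  rate_pos : ∀ π : Fin m → ℝ, (∀ i, 0 ≤ π i) → ∑ i, π i = 1 → π ᵥ* (D₀ + D₁) = π →
    0 < ∑ i, (π ᵥ* D₁) i

/-- The stochastic ingredients of the tandem queue. -/
structure Params (m n₁ n₂ l : ℕ) where
  /-- arrival process: phase transitions without an arrival -/
  D₀ : Matrix (Fin m) (Fin m) ℝ
  /-- arrival process: phase transitions with an arrival -/
  D₁ : Matrix (Fin m) (Fin m) ℝ
  /-- transmission times, `(β₁, S₁)` -/
  tx : DPH n₁
  /-- computation times, `(β₂, S₂)` -/
  comp : DPH n₂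
  /-- vacation durations, `(v, V)` -/
  vac : DPH l

structure Params.IsValid {m n₁ n₂ l : ℕ} (Q : Params m n₁ n₂ l) : Prop where
  dmap : IsDMAP Q.D₀ Q.D₁
  tx : Q.tx.IsValid
  comp : Q.comp.IsValid
  vac : Q.vac.IsValid

/-- The state space `Ψ`: queue lengths (including the tasks in service), the phase of the arrival
process, the phase of server 1 and the phase of server 2. Server 1 is idle (`none`) exactly when
queue 1 is empty; otherwise it is on vacation in some vacation phase (`some (inl j)`) or it
transmits in some transmission phase (`some (inr j)`), the latter only if queue 2 is not full.
Server 2 is idle (`none`) exactly when queue 2 is empty. -/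
structure State (m n₁ n₂ l N₁ N₂ : ℕ) where
  i₁ : Fin (N₁ + 1)
  i₂ : Fin (N₂ + 1)
  ph : Fin m
  p₁ : Option (Fin l ⊕ Fin n₁)
  p₂ : Option (Fin n₂)
  idle₁ : p₁ = none ↔ i₁ = 0
  idle₂ : p₂ = none ↔ i₂ = 0
  full : i₂ = Fin.last N₂ → ∀ j, p₁ ≠ some (Sum.inr j)

noncomputable instance {m n₁ n₂ l N₁ N₂ : ℕ} : Fintype (State m n₁ n₂ l N₁ N₂) :=
  Fintype.ofInjective (fun s => (s.i₁, s.i₂, s.ph, s.p₁, s.p₂)) (by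
    rintro ⟨⟩ ⟨⟩ h
    simpa using h)

/-- What happens during one time slot: whether a task is generated, whether server 1 completes a
transmission, and whether server 2 completes a computation. -/
structure Slot where
  arrival : Bool
  sent : Bool
  done : Bool
deriving DecidableEq, Fintype

section Dynamics

variable {m n₁ n₂ l N₁ N₂ : ℕ}

/-- A generated task enters queue 1 iff there is room for it, possibly room made by a transmission
that completes in the same slot; otherwise it is rejected. -/
def enters (s : State m n₁ n₂ l N₁ N₂) (e : Slot) : Bool :=
  e.arrival && (decide ((s.i₁ : ℕ) < N₁) || e.sent)

/-- Probability of the phase `p'` with which server 2 starts, when it is not busy with a task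
already: idle if there is no task, and a fresh computation phase otherwise. -/
def Params.start₂ (Q : Params m n₁ n₂ l) : Option (Fin n₂) → ℝ
  | none => 1
  | some j => Q.comp.init j

/-- Server 2: probability of the outcome of a slot (`done`: the computation in progress completes)
together with the new phase, given the old phase. -/
def Params.server₂ (Q : Params m n₁ n₂ l) : Option (Fin n₂) → Bool → Option (Fin n₂) → ℝ
  | none, false, p' => Q.start₂ p'
  | none, true, _ => 0
  | some j, false, some j' => Q.comp.trans j j'
  | some _, false, none => 0
  | some j, true, p' => Q.comp.exit j * Q.start₂ p'

/-- Probability of the phase with which server 1 starts, when it has to decide what to do next: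
idle if queue 1 is empty; otherwise a new vacation if queue 2 is full and a new transmission if
queue 2 is not full. -/
def Params.start₁ (Q : Params m n₁ n₂ l) (full : Bool) : Option (Fin l ⊕ Fin n₁) → ℝ
  | none => 1
  | some (Sum.inl j) => if full then Q.vac.init j else 0
  | some (Sum.inr j) => if full then 0 else Q.tx.init j

/-- Server 1: probability of the outcome of a slot (`sent`: the transmission in progress completes)
together with the new phase, given the old phase; `full` says whether queue 2 is full at the end of
the slot. -/
def Params.server₁ (Q : Params m n₁ n₂ l) (full : Bool) :
    Option (Fin l ⊕ Fin n₁) → Bool → Option (Fin l ⊕ Fin n₁) → ℝ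
  | none, false, p' => Q.start₁ full p'
  | none, true, _ => 0
  | some (Sum.inr j), false, some (Sum.inr j') => Q.tx.trans j j'
  | some (Sum.inr _), false, _ => 0
  | some (Sum.inr j), true, p' => Q.tx.exit j * Q.start₁ full p'
  | some (Sum.inl j), false, some (Sum.inl j') =>
      Q.vac.trans j j' + Q.vac.exit j * Q.start₁ full (some (Sum.inl j'))
  | some (Sum.inl j), false, some (Sum.inr j') =>
      Q.vac.exit j * Q.start₁ full (some (Sum.inr j'))
  | some (Sum.inl _), false, none => 0
  | some (Sum.inl _), true, _ => 0

/-- The probability that, from state `s`, the events of the next slot are `e` and the state at the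
end of the slot is `s'`. -/
noncomputable def Params.step (Q : Params m n₁ n₂ l) (s : State m n₁ n₂ l N₁ N₂) (e : Slot)
    (s' : State m n₁ n₂ l N₁ N₂) : ℝ :=
  if (s'.i₁ : ℕ) + e.sent.toNat = s.i₁ + (enters s e).toNat ∧
      (s'.i₂ : ℕ) + e.done.toNat = s.i₂ + e.sent.toNat then
    (if e.arrival then Q.D₁ else Q.D₀) s.ph s'.ph *
      Q.server₁ (decide (s'.i₂ = Fin.last N₂)) s.p₁ e.sent s'.p₁ *
      Q.server₂ s.p₂ e.done s'.p₂
  else 0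

/-- The one-step transition probability matrix `P` of the chain `Ξ` on `Ψ`. -/
noncomputable def Params.P (Q : Params m n₁ n₂ l) (N₁ N₂ : ℕ) :
    Matrix (State m n₁ n₂ l N₁ N₂) (State m n₁ n₂ l N₁ N₂) ℝ :=
  fun s s' => ∑ e : Slot, Q.step s e s'

/-- The part `P̂` of `P` that belongs to transitions in which a task enters queue 1. -/
noncomputable def Params.Phat (Q : Params m n₁ n₂ l) (N₁ N₂ : ℕ) :
    Matrix (State m n₁ n₂ l N₁ N₂) (State m n₁ n₂ l N₁ N₂) ℝ :=
  fun s s' => ∑ e : Slot, if enters s e then Q.step s e s' else 0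

/-- The same system without new arrivals: `D₀` is replaced by `I` and `D₁` by `0`. -/
def Params.noArrivals (Q : Params m n₁ n₂ l) : Params m n₁ n₂ l :=
  { Q with D₀ := 1, D₁ := 0 }

/-- `x` is a stationary distribution of the chain `Ξ`. -/
structure Params.IsStationary (Q : Params m n₁ n₂ l) (x : State m n₁ n₂ l N₁ N₂ → ℝ) : Prop where
  nonneg : ∀ s, 0 ≤ x s
  sum_eq_one : ∑ s, x s = 1
  stationary : x ᵥ* Q.P N₁ N₂ = x

/-- The stationary distribution `z` just after a task enters queue 1: `x P̂`, normalized. -/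
noncomputable def Params.z (Q : Params m n₁ n₂ l) (x : State m n₁ n₂ l N₁ N₂ → ℝ) :
    State m n₁ n₂ l N₁ N₂ → ℝ :=
  (∑ s, (x ᵥ* Q.Phat N₁ N₂) s)⁻¹ • (x ᵥ* Q.Phat N₁ N₂)

/-- The distribution `x̃⁽ⁿ⁾` after `n` slots of the chain without new arrivals, started from `z`. -/
noncomputable def Params.xTilde (Q : Params m n₁ n₂ l) (x : State m n₁ n₂ l N₁ N₂ → ℝ) :
    ℕ → State m n₁ n₂ l N₁ N₂ → ℝ
  | 0 => Q.z x
  | n + 1 => Q.xTilde x n ᵥ* Q.noArrivals.P N₁ N₂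

open Classical in
/-- The mass `y₀₀ e` that a vector `y` on `Ψ` puts on level `(0, 0)`. -/
noncomputable def emptyMass (y : State m n₁ n₂ l N₁ N₂ → ℝ) : ℝ :=
  ∑ s, if s.i₁ = 0 ∧ s.i₂ = 0 then y s else 0

/-- The contents of queue 1 and of queue 2 (heads of the queues first) at the times `t_k`, along a
trajectory of states `s` and slot events `e`; slot `k` lasts from `t_k` to `t_{k+1}`. Each task is
labelled by the index of the time at which it enters queue 1, the tasks that are in the system at
`t_0` by `0`. Both queues are FIFO. -/
def contents (s : ℕ → State m n₁ n₂ l N₁ N₂) (e : ℕ → Slot) : ℕ → List ℕ × List ℕ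
  | 0 => (List.replicate (s 0).i₁ 0, List.replicate (s 0).i₂ 0)
  | k + 1 =>
    let q := contents s e k
    ((if (e k).sent then q.1.tail else q.1) ++ (if enters (s k) (e k) then [k + 1] else []),
      (if (e k).done then q.2.tail else q.2) ++ (if (e k).sent then q.1.take 1 else []))

/-- The computation of the task with label `a` completes in slot `k`. -/
def completes (s : ℕ → State m n₁ n₂ l N₁ N₂) (e : ℕ → Slot) (k a : ℕ) : Prop :=
  (e k).done = true ∧ (contents s e k).2.head? = some a

/-- The delay, in slots, of the task that enters queue 1 in slot `k`, that is, at `t_{k+1}`: it is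
`n` if the computation of this task completes in slot `k + n`, that is, at `t_{k+1+n}`, and `⊤` if
the computation never completes. -/
noncomputable def delay (s : ℕ → State m n₁ n₂ l N₁ N₂) (e : ℕ → Slot) (k : ℕ) : ℕ∞ :=
  ⨅ (n : ℕ) (_ : completes s e (k + n) (k + 1)), (n : ℕ∞)

open MeasureTheory in
/-- The random states `X k` at `t_k` and slot events `E k` are a realization, on the probability
space `(Ω, μ)`, of the tandem queue with initial distribution `x`. -/
structure Params.IsRealization (Q : Params m n₁ n₂ l) (x : State m n₁ n₂ l N₁ N₂ → ℝ)
    {Ω : Type*} [MeasurableSpace Ω] (μ : Measure Ω)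
    (X : ℕ → Ω → State m n₁ n₂ l N₁ N₂) (E : ℕ → Ω → Slot) : Prop where
  measurable_state : ∀ k a, MeasurableSet {ω | X k ω = a}
  measurable_slot : ∀ k a, MeasurableSet {ω | E k ω = a}
  law : ∀ (k : ℕ) (s : ℕ → State m n₁ n₂ l N₁ N₂) (e : ℕ → Slot),
    μ.real {ω | (∀ i ≤ k, X i ω = s i) ∧ ∀ i < k, E i ω = e i} =
      x (s 0) * ∏ i ∈ Finset.range k, Q.step (s i) (e i) (s (i + 1))

end Dynamics

/-- The event that a task enters queue 1 in slot `k`. -/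
def enterEvent {m n₁ n₂ l N₁ N₂ : ℕ} {Ω : Type*} (X : ℕ → Ω → State m n₁ n₂ l N₁ N₂)
    (E : ℕ → Ω → Slot) (k : ℕ) : Set Ω :=
  {ω | enters (X k ω) (E k ω) = true}

/-- The delay of the task that enters queue 1 in slot `k`, as a random variable. -/
noncomputable def randomDelay {m n₁ n₂ l N₁ N₂ : ℕ} {Ω : Type*}
    (X : ℕ → Ω → State m n₁ n₂ l N₁ N₂) (E : ℕ → Ω → Slot) (k : ℕ) (ω : Ω) : ℕ∞ :=
  delay (fun i => X i ω) (fun i => E i ω) k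

/-- `P{T ∈ A}`: the probability that the delay of the task that enters queue 1 in slot `k` lies in
`A`, given that a task enters queue 1 in slot `k`. -/
noncomputable def delayProb {m n₁ n₂ l N₁ N₂ : ℕ} {Ω : Type*} [MeasurableSpace Ω]
    (μ : MeasureTheory.Measure Ω) (X : ℕ → Ω → State m n₁ n₂ l N₁ N₂) (E : ℕ → Ω → Slot)
    (k : ℕ) (A : Set ℕ∞) : ℝ :=
  (ProbabilityTheory.cond μ (enterEvent X E k)).real {ω | randomDelay X E k ω ∈ A}

end TandemQueue

/-!
Both queues are FIFO, so a task leaves the system when as many computations have completed as there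
are tasks in the system, itself included, right after its entry. Tasks that arrive later do not
affect these computations: as long as one of the earlier tasks is in queue 1, server 1 is busy
anyway, and once all that remain of them are in queue 2, server 2 completes them whatever server 1
does. Hence up to the tagged one the computations have the same law as in the system without
arrivals started right after the entry, and that system is empty as soon as the tagged task has
left. A task does enter with positive probability: otherwise stationarity would exclude
transmissions and computations as well, the nonsingularity of `I - T` would then force both servers
to be idle, and the tasks generated at a positive rate would all find room in queue 1.
-/

namespace TandemQueue

open MeasureTheory
open scoped Matrix

section MarkedChain

variable {S B Ω : Type*}

/-- An event on `Ω` is determined up to time `j` if it depends only on the states `X 0, …, X j` and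
the marks `E 0, …, E (j - 1)` of the transitions between them. -/
def IsDeterminedUpTo (X : ℕ → Ω → S) (E : ℕ → Ω → B) (j : ℕ) (A : Set Ω) : Prop :=
  ∀ ⦃ω ω'⦄, (∀ i ≤ j, X i ω = X i ω') → (∀ i < j, E i ω = E i ω') → ω ∈ A → ω' ∈ A

/-- The history up to time `j`: the values that an event determined up to time `j` depends on. -/
def history (X : ℕ → Ω → S) (E : ℕ → Ω → B) (j : ℕ) (ω : Ω) : (Fin (j + 1) → S) × (Fin j → B) :=
  (fun i ↦ X i ω, fun i ↦ E i ω)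

/-- The states `X` and marks `E` form a Markov chain in which each transition carries a mark:
`κ s e s'` is the probability that a transition from `s` has mark `e` and leads to `s'`, and `x` is
the initial law. -/
structure IsMarkedChain [MeasurableSpace Ω] (x : S → ℝ) (κ : S → B → S → ℝ) (μ : Measure Ω)
    (X : ℕ → Ω → S) (E : ℕ → Ω → B) : Prop where
  measurable_state : ∀ k a, MeasurableSet {ω | X k ω = a}
  measurable_mark : ∀ k a, MeasurableSet {ω | E k ω = a}
  law : ∀ (k : ℕ) (s : ℕ → S) (e : ℕ → B),
    μ.real {ω | (∀ i ≤ k, X i ω = s i) ∧ ∀ i < k, E i ω = e i} =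
      x (s 0) * ∏ i ∈ Finset.range k, κ (s i) (e i) (s (i + 1))

theorem history_eq_iff {X : ℕ → Ω → S} {E : ℕ → Ω → B} {j : ℕ} {ω ω' : Ω} :
    history X E j ω = history X E j ω' ↔
      (∀ i ≤ j, X i ω = X i ω') ∧ ∀ i < j, E i ω = E i ω' := by
  simp only [history, Prod.ext_iff, funext_iff, Fin.forall_iff, Nat.lt_succ_iff]

theorem isDeterminedUpTo_state (X : ℕ → Ω → S) (E : ℕ → Ω → B) (j : ℕ) (s : S) :
    IsDeterminedUpTo X E j {ω | X j ω = s} :=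
  fun _ _ hX _ h ↦ (hX j le_rfl).symm.trans h

theorem IsDeterminedUpTo.inter_step {X : ℕ → Ω → S} {E : ℕ → Ω → B} {j : ℕ} {A : Set Ω}
    (hA : IsDeterminedUpTo X E j A) (e : B) (s' : S) :
    IsDeterminedUpTo X E (j + 1) (A ∩ {ω | E j ω = e ∧ X (j + 1) ω = s'}) :=
  fun _ _ hX hE h ↦
    ⟨hA (fun i hi ↦ hX i (Nat.le_succ_of_le hi)) (fun i hi ↦ hE i (Nat.lt_succ_of_lt hi)) h.1,
      (hE j j.lt_succ_self).symm.trans h.2.1, (hX (j + 1) le_rfl).symm.trans h.2.2⟩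

theorem measureReal_eq_sum_fiber [MeasurableSpace Ω] (μ : Measure Ω) [IsFiniteMeasure μ]
    {β : Type*} [Fintype β] {Y : Ω → β} (hY : ∀ y, MeasurableSet {ω | Y ω = y}) (A : Set Ω) :
    μ.real A = ∑ y, μ.real (A ∩ {ω | Y ω = y}) := by
  have h := sum_measureReal_preimage_singleton (μ := μ.restrict A) (f := Y) Finset.univ
    fun y _ ↦ hY y
  rw [Finset.coe_univ, Set.preimage_univ, measureReal_restrict_apply_univ] at h
  rw [← h]
  refine Finset.sum_congr rfl fun y _ ↦ ?_
  rw [measureReal_restrict_apply (show MeasurableSet (Y ⁻¹' {y}) from hY y), Set.inter_comm]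
  rfl

/-- For a kernel `κ` of marked transitions, the probability that the marks of `n` transitions from
`s` have total weight at least `r`. The truncated subtraction keeps `r` at `0` once the weight has
been reached. -/
def tailProb [Fintype S] [Fintype B] (κ : S → B → S → ℝ) (w : B → ℕ) : ℕ → S → ℕ → ℝ
  | 0, _, r => if r = 0 then 1 else 0
  | n + 1, s, r => ∑ e, ∑ s', κ s e s' * tailProb κ w n s' (r - w e)

namespace IsMarkedChain

variable [MeasurableSpace Ω] {x : S → ℝ} {κ : S → B → S → ℝ} {μ : Measure Ω}
  {X : ℕ → Ω → S} {E : ℕ → Ω → B}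

theorem measurableSet_mark_state (h : IsMarkedChain x κ μ X E) (i j : ℕ) (y : B × S) :
    MeasurableSet {ω | (E i ω, X j ω) = y} := by
  simp only [Prod.ext_iff, Set.ofPred_and]
  exact (h.measurable_mark i _).inter (h.measurable_state j _)

theorem measurableSet_history (h : IsMarkedChain x κ μ X E) (j : ℕ) (y) :
    MeasurableSet {ω | history X E j ω = y} := by
  simp only [history, Prod.ext_iff, funext_iff, Set.ofPred_and, Set.ofPred_forall]
  exact (MeasurableSet.iInter fun i : Fin (j + 1) ↦ h.measurable_state i (y.1 i)).inter
    (MeasurableSet.iInter fun i : Fin j ↦ h.measurable_mark i (y.2 i))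

theorem measurableSet_of_isDeterminedUpTo [Finite S] [Finite B] (h : IsMarkedChain x κ μ X E)
    {j : ℕ} {A : Set Ω} (hA : IsDeterminedUpTo X E j A) : MeasurableSet A := by
  have hA' : A = ⋃ y ∈ history X E j '' A, {ω | history X E j ω = y} := by
    refine Set.Subset.antisymm (fun ω hω ↦ ?_) ?_
    · exact Set.mem_biUnion (Set.mem_image_of_mem _ hω) rfl
    · simp only [Set.iUnion_subset_iff, Set.forall_mem_image]
      intro ω hω ω' hω'
      obtain ⟨hX, hE⟩ := history_eq_iff.1 hω'.symm
      exact hA hX hE hω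
  rw [hA']
  exact (Set.toFinite _).measurableSet_biUnion fun y _ ↦ h.measurableSet_history j y

theorem measureReal_history_inter_step (h : IsMarkedChain x κ μ X E) (j : ℕ) (ω₀ : Ω) (e : B)
    (s' : S) :
    μ.real ({ω | history X E j ω = history X E j ω₀} ∩ {ω | E j ω = e ∧ X (j + 1) ω = s'}) =
      μ.real {ω | history X E j ω = history X E j ω₀} * κ (X j ω₀) e s' := by
  let σ : ℕ → S := Function.update (fun i ↦ X i ω₀) (j + 1) s'
  let ε : ℕ → B := Function.update (fun i ↦ E i ω₀) j e
  have hσ : ∀ i ≤ j, σ i = X i ω₀ := fun i hi ↦ Function.update_of_ne (by omega) _ _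
  have hε : ∀ i < j, ε i = E i ω₀ := fun i hi ↦ Function.update_of_ne hi.ne _ _
  have hσ' : σ (j + 1) = s' := Function.update_self ..
  have hε' : ε j = e := Function.update_self ..
  have past : {ω | history X E j ω = history X E j ω₀} =
      {ω | (∀ i ≤ j, X i ω = σ i) ∧ ∀ i < j, E i ω = ε i} := by
    ext ω
    simp +contextual only [Set.mem_ofPred_eq, history_eq_iff, hσ, hε]
  have future : {ω | history X E j ω = history X E j ω₀} ∩ {ω | E j ω = e ∧ X (j + 1) ω = s'} =
      {ω | (∀ i ≤ j + 1, X i ω = σ i) ∧ ∀ i < j + 1, E i ω = ε i} := by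
    ext ω
    simp only [past, Set.mem_inter_iff, Set.mem_ofPred_eq, Nat.le_succ_iff,
      Nat.lt_succ_iff_lt_or_eq, or_imp, forall_and, forall_eq, hσ', hε']
    tauto
  rw [future, past, h.law, h.law, Finset.prod_range_succ, hσ j le_rfl, hε', hσ', mul_assoc]

variable [IsFiniteMeasure μ]

theorem measureReal_inter_step [Finite S] [Finite B] (h : IsMarkedChain x κ μ X E) {j : ℕ}
    {A : Set Ω} {s : S} (hA : IsDeterminedUpTo X E j A) (hs : A ⊆ {ω | X j ω = s}) (e : B)
    (s' : S) :
    μ.real (A ∩ {ω | E j ω = e ∧ X (j + 1) ω = s'}) = μ.real A * κ s e s' := by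
  have := Fintype.ofFinite S
  have := Fintype.ofFinite B
  rw [measureReal_eq_sum_fiber μ (h.measurableSet_history j),
    measureReal_eq_sum_fiber μ (h.measurableSet_history j) A, Finset.sum_mul]
  refine Finset.sum_congr rfl fun y _ ↦ ?_
  rw [Set.inter_right_comm]
  rcases Set.eq_empty_or_nonempty (A ∩ {ω | history X E j ω = y}) with hy | ⟨ω₀, hω₀, rfl⟩
  · simp only [hy, Set.empty_inter, measureReal_empty, zero_mul]
  · have hsub : {ω | history X E j ω = history X E j ω₀} ⊆ A := fun ω hω ↦
      have ⟨hX, hE⟩ := history_eq_iff.1 hω.symm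
      hA hX hE hω₀
    rw [Set.inter_eq_right.2 hsub, h.measureReal_history_inter_step, hs hω₀]

theorem ae_ne_zero [Finite S] [Finite B] (h : IsMarkedChain x κ μ X E) :
    ∀ᵐ ω ∂μ, ∀ k, κ (X k ω) (E k ω) (X (k + 1) ω) ≠ 0 := by
  have hnull : ∀ᵐ ω ∂μ, ∀ k s e s', κ s e s' = 0 →
      ω ∉ {ω | X k ω = s} ∩ {ω | E k ω = e ∧ X (k + 1) ω = s'} := by
    simp only [ae_all_iff]
    intro k s e s' hκ
    refine measure_eq_zero_iff_ae_notMem.1 ((measureReal_eq_zero_iff).1 ?_)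
    rw [h.measureReal_inter_step (isDeterminedUpTo_state X E k s) subset_rfl, hκ, mul_zero]
  filter_upwards [hnull] with ω hω k hκ
  exact hω k _ _ _ hκ ⟨rfl, rfl, rfl⟩

variable [Fintype S] [Fintype B]

theorem measureReal_inter_le_sum (h : IsMarkedChain x κ μ X E) (w : B → ℕ) (n : ℕ) {j : ℕ}
    {A : Set Ω} {s : S} (hA : IsDeterminedUpTo X E j A) (hs : A ⊆ {ω | X j ω = s}) (r : ℕ) :
    μ.real (A ∩ {ω | r ≤ ∑ i ∈ Finset.range n, w (E (j + i) ω)}) =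
      μ.real A * tailProb κ w n s r := by
  induction n generalizing j A s r with
  | zero => by_cases hr : r = 0 <;> simp [tailProb, hr]
  | succ n ih =>
    rw [measureReal_eq_sum_fiber μ (h.measurableSet_mark_state j (j + 1)), tailProb,
      Fintype.sum_prod_type, Finset.mul_sum]
    refine Finset.sum_congr rfl fun e _ ↦ ?_
    rw [Finset.mul_sum]
    refine Finset.sum_congr rfl fun s' _ ↦ ?_
    rw [← mul_assoc, ← h.measureReal_inter_step hA hs, ← ih (hA.inter_step e s') fun _ hω ↦ hω.2.2]
    congr 1
    ext ω
    have hcount : E j ω = e → (r ≤ ∑ i ∈ Finset.range (n + 1), w (E (j + i) ω) ↔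
        r - w e ≤ ∑ i ∈ Finset.range n, w (E (j + 1 + i) ω)) := by
      rintro rfl
      simp only [Finset.sum_range_succ', add_zero, tsub_le_iff_right, Nat.add_assoc, Nat.add_comm 1]
    simp only [Set.mem_inter_iff, Set.mem_ofPred_eq, Prod.mk.injEq]
    tauto

theorem measureReal_state (h : IsMarkedChain x κ μ X E)
    (hx : x ᵥ* Matrix.of (fun s s' ↦ ∑ e, κ s e s') = x) (k : ℕ) (s : S) :
    μ.real {ω | X k ω = s} = x s := by
  induction k generalizing s with
  | zero =>
    rcases isEmpty_or_nonempty B with hB | ⟨⟨e⟩⟩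
    · have : IsEmpty Ω := ⟨fun ω ↦ hB.elim (E 0 ω)⟩
      rw [← hx, Set.eq_empty_of_isEmpty {ω | X 0 ω = s}, measureReal_empty]
      simp only [Matrix.vecMul, dotProduct, Matrix.of_apply, Finset.univ_eq_empty,
        Finset.sum_empty, mul_zero, Finset.sum_const_zero]
    · simpa using h.law 0 (fun _ ↦ s) (fun _ ↦ e)
  | succ k ih =>
    rw [measureReal_eq_sum_fiber μ (h.measurableSet_mark_state k k), Fintype.sum_prod_type_right,
      ← congrFun hx s]
    refine Finset.sum_congr rfl fun s₀ _ ↦ ?_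
    simp only [Matrix.of_apply]
    rw [Finset.mul_sum, ← ih]
    refine Finset.sum_congr rfl fun e _ ↦ ?_
    rw [← h.measureReal_inter_step (isDeterminedUpTo_state X E k s₀) subset_rfl]
    congr 1
    ext ω
    simp only [Set.mem_inter_iff, Set.mem_ofPred_eq, Prod.mk.injEq]
    tauto

theorem measureReal_step_inter_le_sum (h : IsMarkedChain x κ μ X E)
    (hx : x ᵥ* Matrix.of (fun s s' ↦ ∑ e, κ s e s') = x) (c : S → B → Bool) (w : B → ℕ)
    (r : S → ℕ) (k n : ℕ) :
    μ.real ({ω | c (X k ω) (E k ω) = true} ∩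
        {ω | r (X (k + 1) ω) ≤ ∑ i ∈ Finset.range n, w (E (k + 1 + i) ω)}) =
      (x ᵥ* Matrix.of fun s s' ↦ ∑ e, if c s e then κ s e s' else 0) ⬝ᵥ
        fun s' ↦ tailProb κ w n s' (r s') := by
  simp only [dotProduct, Matrix.vecMul, Matrix.of_apply, Finset.mul_sum, Finset.sum_mul]
  rw [measureReal_eq_sum_fiber μ (h.measurable_state (k + 1))]
  refine Finset.sum_congr rfl fun s' _ ↦ ?_
  rw [measureReal_eq_sum_fiber μ (h.measurable_state k)]
  refine Finset.sum_congr rfl fun s _ ↦ ?_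
  rw [measureReal_eq_sum_fiber μ (h.measurable_mark k)]
  refine Finset.sum_congr rfl fun e _ ↦ ?_
  have hstate := isDeterminedUpTo_state X E k s
  by_cases hc : c s e
  · rw [if_pos hc, ← h.measureReal_state hx k s, ← h.measureReal_inter_step hstate subset_rfl,
      ← h.measureReal_inter_le_sum w n (hstate.inter_step e s') fun _ hω ↦ hω.2.2]
    congr 1
    ext ω
    simp only [Set.mem_inter_iff, Set.mem_ofPred_eq]
    constructor
    · rintro ⟨⟨⟨⟨-, hle⟩, rfl⟩, rfl⟩, rfl⟩
      exact ⟨⟨rfl, rfl, rfl⟩, hle⟩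
    · rintro ⟨⟨rfl, rfl, rfl⟩, hle⟩
      exact ⟨⟨⟨⟨hc, hle⟩, rfl⟩, rfl⟩, rfl⟩
  · rw [if_neg hc, mul_zero, zero_mul, measureReal_eq_zero_iff, measure_eq_zero_iff_ae_notMem]
    refine .of_forall ?_
    rintro ω ⟨⟨⟨⟨henters, -⟩, -⟩, rfl⟩, rfl⟩
    exact hc henters

end IsMarkedChain

end MarkedChain

section Stationary

variable {S B : Type*} {x : S → ℝ} {κ : S → B → S → ℝ}

/-- In the stationary regime `x`, transitions for which `c` holds have probability zero. -/
def Never (κ : S → B → S → ℝ) (x : S → ℝ) (c : S → B → Prop) : Prop :=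
  ∀ ⦃s e s'⦄, x s ≠ 0 → c s e → κ s e s' = 0

theorem Never.eq_false {c : S → B → Bool} (h : Never κ x fun s e ↦ c s e = true) {s s' : S}
    {e : B} (hs : x s ≠ 0) (hκ : κ s e s' ≠ 0) : c s e = false :=
  Bool.eq_false_of_not_eq_true fun hc ↦ hκ (h hs hc)

variable [Fintype S] [Fintype B]

theorem balance (hx : x ᵥ* Matrix.of (fun s s' ↦ ∑ e, κ s e s') = x) (f : S → ℝ) :
    ∑ s, x s * ∑ e, ∑ s', κ s e s' * f s' = ∑ s, x s * f s := by
  calc ∑ s, x s * ∑ e, ∑ s', κ s e s' * f s'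
      = x ⬝ᵥ Matrix.of (fun s s' ↦ ∑ e, κ s e s') *ᵥ f := by
        simp only [dotProduct, Matrix.mulVec, Matrix.of_apply, Finset.sum_mul]
        exact Finset.sum_congr rfl fun s _ ↦ congrArg _ Finset.sum_comm
    _ = ∑ s, x s * f s := by rw [Matrix.dotProduct_mulVec, hx, dotProduct]

/-- Stationarity keeps the mean of `f` fixed, so the transitions that decrease it do not occur. -/
theorem never_of_add_eq (hx : x ᵥ* Matrix.of (fun s s' ↦ ∑ e, κ s e s') = x) (hx0 : ∀ s, 0 ≤ x s)
    (hκ0 : ∀ s e s', 0 ≤ κ s e s') (hκ : ∀ s, ∑ e, ∑ s', κ s e s' = 1) {f : S → ℕ} {c : B → Bool}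
    (h : ∀ s e s', x s ≠ 0 → κ s e s' ≠ 0 → f s' + (c e).toNat = f s) :
    Never κ x fun _ e ↦ c e = true := by
  have hflow : ∀ s e s', 0 ≤ x s * (κ s e s' * (c e).toNat) := fun s e s' ↦
    mul_nonneg (hx0 s) (mul_nonneg (hκ0 s e s') (Nat.cast_nonneg _))
  have hterm : ∀ s e s', x s * (κ s e s' * f s') + x s * (κ s e s' * (c e).toNat) =
      x s * (κ s e s' * f s) := fun s e s' ↦ by
    by_cases hs : x s = 0
    · simp only [hs, zero_mul, add_zero]
    by_cases hk : κ s e s' = 0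
    · simp only [hk, zero_mul, mul_zero, add_zero]
    · rw [← h s e s' hs hk]
      push_cast
      ring
  have hsum : ∑ s, ∑ e, ∑ s', x s * (κ s e s' * (c e).toNat) = 0 := by
    have hb := balance hx fun s ↦ (f s : ℝ)
    have hone : ∑ s, ∑ e, ∑ s', x s * (κ s e s' * f s) = ∑ s, x s * f s := by
      simp only [← Finset.mul_sum, ← Finset.sum_mul, hκ, one_mul]
    simp only [← hterm, Finset.sum_add_distrib, ← Finset.mul_sum, hb] at hone
    simpa only [← Finset.mul_sum, add_eq_left] using hone
  intro s e s' hs hc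
  simp only [← Fintype.sum_prod_type'] at hsum
  have hzero := (Finset.sum_eq_zero_iff_of_nonneg fun _ _ ↦ hflow _ _ _).1 hsum (s, e, s')
    (Finset.mem_univ _)
  simpa only [hc, Bool.toNat_true, Nat.cast_one, mul_one, mul_eq_zero, hs, false_or] using hzero

/-- The mass that `x` puts on the states to which `g` assigns the phase `j`. -/
def phaseMass {ι : Type*} [DecidableEq ι] (x : S → ℝ) (g : S → Option ι) (j : ι) : ℝ :=
  ∑ s, if g s = some j then x s else 0

theorem sum_phaseMass_mul {ι : Type*} [Fintype ι] [DecidableEq ι] (g : S → Option ι)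
    (f : ι → ℝ) : ∑ j, phaseMass x g j * f j = ∑ s, x s * (g s).elim 0 f := by
  simp only [phaseMass, Finset.sum_mul, ite_mul, zero_mul]
  rw [Finset.sum_comm]
  refine Finset.sum_congr rfl fun s _ ↦ ?_
  cases hg : g s <;> simp

theorem phaseMass_vecMul {ι : Type*} [Fintype ι] [DecidableEq ι]
    (hx : x ᵥ* Matrix.of (fun s s' ↦ ∑ e, κ s e s') = x) {g : S → Option ι} {T : Matrix ι ι ℝ}
    (h : ∀ s, x s ≠ 0 → ∀ j,
      ∑ e, ∑ s', κ s e s' * (if g s' = some j then 1 else 0) = (g s).elim 0 (T · j)) :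
    phaseMass x g ᵥ* T = phaseMass x g := by
  ext j
  calc (phaseMass x g ᵥ* T) j
      = ∑ s, x s * (g s).elim 0 (T · j) := sum_phaseMass_mul g (T · j)
    _ = ∑ s, x s * ∑ e, ∑ s', κ s e s' * (if g s' = some j then 1 else 0) := by
        refine Finset.sum_congr rfl fun s _ ↦ ?_
        by_cases hs : x s = 0
        · simp only [hs, zero_mul]
        · rw [h s hs j]
    _ = phaseMass x g j := by
        rw [balance hx, phaseMass]
        simp only [mul_ite, mul_one, mul_zero]

theorem eq_none_of_isUnit_one_sub {ι : Type*} [Fintype ι] [DecidableEq ι]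
    (hx : x ᵥ* Matrix.of (fun s s' ↦ ∑ e, κ s e s') = x) (hx0 : ∀ s, 0 ≤ x s) {g : S → Option ι}
    {T : Matrix ι ι ℝ} (hT : IsUnit (1 - T))
    (h : ∀ s, x s ≠ 0 → ∀ j,
      ∑ e, ∑ s', κ s e s' * (if g s' = some j then 1 else 0) = (g s).elim 0 (T · j))
    {s : S} (hs : x s ≠ 0) : g s = none := by
  have hmass : phaseMass x g = 0 := by
    refine Matrix.vecMul_injective_iff_isUnit.2 hT ?_
    simp only [Matrix.vecMul_sub, Matrix.vecMul_one, phaseMass_vecMul hx h, sub_self,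
      Matrix.zero_vecMul]
  rw [Option.eq_none_iff_forall_ne_some]
  intro j hj
  have hzero := (Finset.sum_eq_zero_iff_of_nonneg fun s _ ↦ ite_nonneg (hx0 s) le_rfl).1
    (congrFun hmass j) s (Finset.mem_univ s)
  exact hs (by rwa [if_pos hj] at hzero)

end Stationary

section Fifo

variable {m n₁ n₂ l N₁ N₂ : ℕ}

/-- The balance of the queue lengths over a slot with events `e`, in which server `i` can complete
a service only if queue `i` is nonempty. -/
structure IsFeasible (s : State m n₁ n₂ l N₁ N₂) (e : Slot) (s' : State m n₁ n₂ l N₁ N₂) :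
    Prop where
  sent_le : e.sent.toNat ≤ s.i₁
  done_le : e.done.toNat ≤ s.i₂
  i₁_add : s'.i₁ + e.sent.toNat = s.i₁ + (enters s e).toNat
  i₂_add : s'.i₂ + e.done.toNat = s.i₂ + e.sent.toNat

/-- The labels of the tasks in the system, in the order in which they leave it. -/
def tasks (s : ℕ → State m n₁ n₂ l N₁ N₂) (e : ℕ → Slot) (k : ℕ) : List ℕ :=
  (contents s e k).2 ++ (contents s e k).1

/-- The number of computations that complete in the `n` slots from slot `k` on. -/
def doneCount (e : ℕ → Slot) (k n : ℕ) : ℕ :=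
  ∑ i ∈ Finset.range n, (e (k + i)).done.toNat

theorem doneCount_succ (e : ℕ → Slot) (k n : ℕ) :
    doneCount e k (n + 1) = doneCount e k n + (e (k + n)).done.toNat :=
  Finset.sum_range_succ _ _

theorem exists_done_and_doneCount_eq_iff (e : ℕ → Slot) (k n r : ℕ) :
    (∃ j < n, (e (k + j)).done = true ∧ doneCount e k j = r) ↔ r < doneCount e k n := by
  induction n with
  | zero => simp [doneCount]
  | succ n ih =>
    simp only [Nat.lt_succ_iff_lt_or_eq, or_and_right, exists_or, ih, exists_eq_left,
      doneCount_succ]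
    cases (e (k + n)).done
    · simp only [Bool.false_eq_true, false_and, or_false, Bool.toNat_false, add_zero]
    · simp only [true_and, Bool.toNat_true, Nat.lt_succ_iff_lt_or_eq, eq_comm]

theorem getElem?_append_cons_eq_some_iff {α : Type*} {a : α} {l₁ l₂ : List α} (h₁ : a ∉ l₁)
    (h₂ : a ∉ l₂) (n : ℕ) : (l₁ ++ a :: l₂)[n]? = some a ↔ n = l₁.length := by
  constructor
  · intro h
    rcases lt_trichotomy n l₁.length with hn | hn | hn
    · rw [List.getElem?_append_left hn] at h
      exact absurd (List.mem_of_getElem? h) h₁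
    · exact hn
    · obtain ⟨i, rfl⟩ := Nat.exists_eq_add_of_lt hn
      rw [add_assoc, List.getElem?_append_right (Nat.le_add_right _ _), Nat.add_sub_cancel_left,
        List.getElem?_cons_succ] at h
      exact absurd (List.mem_of_getElem? h) h₂
  · rintro rfl
    rw [List.getElem?_append_right le_rfl, Nat.sub_self, List.getElem?_cons_zero]

variable {s : ℕ → State m n₁ n₂ l N₁ N₂} {e : ℕ → Slot}

theorem length_contents (h : ∀ k, IsFeasible (s k) (e k) (s (k + 1))) (k : ℕ) :
    (contents s e k).1.length = (s k).i₁ ∧ (contents s e k).2.length = (s k).i₂ := by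
  induction k with
  | zero => simp [contents]
  | succ k ih =>
    obtain ⟨hsent, hdone, h₁, h₂⟩ := h k
    simp only [contents]
    cases hs : (e k).sent <;> cases hd : (e k).done <;> cases he : enters (s k) (e k) <;>
      simp [hs, hd, he, ih] at * <;> omega

theorem length_tasks (h : ∀ k, IsFeasible (s k) (e k) (s (k + 1))) (k : ℕ) :
    (tasks s e k).length = (s k).i₁ + (s k).i₂ := by
  rw [tasks, List.length_append, (length_contents h k).1, (length_contents h k).2, add_comm]

theorem tasks_succ (h : ∀ k, IsFeasible (s k) (e k) (s (k + 1))) (k : ℕ) :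
    tasks s e (k + 1) = (tasks s e k).drop (e k).done.toNat ++
      (if enters (s k) (e k) then [k + 1] else []) := by
  have hdone : (e k).done.toNat ≤ (contents s e k).2.length :=
    (length_contents h k).2 ▸ (h k).done_le
  have htransfer : (if (e k).sent then (contents s e k).1.take 1 else []) ++
      (if (e k).sent then (contents s e k).1.tail else (contents s e k).1) =
        (contents s e k).1 := by
    split_ifs
    · rw [← List.drop_one, List.take_append_drop]
    · rfl
  have hleave : (if (e k).done then (contents s e k).2.tail else (contents s e k).2) =
      (contents s e k).2.drop (e k).done.toNat := by
    cases (e k).done <;> simp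
  rw [tasks, contents, hleave, ← List.append_assoc, List.append_assoc _ _ (ite _ (List.tail _) _),
    htransfer, tasks, List.drop_append_of_le_length hdone]

theorem exists_tasks_add_eq_drop (h : ∀ k, IsFeasible (s k) (e k) (s (k + 1))) (k j : ℕ) :
    ∃ new, (∀ a ∈ new, k < a) ∧ tasks s e (k + j) = (tasks s e k ++ new).drop (doneCount e k j) ∧
      doneCount e k j ≤ (tasks s e k ++ new).length := by
  induction j with
  | zero => exact ⟨[], by simp [doneCount]⟩
  | succ j ih =>
    obtain ⟨new, hnew, heq, hle⟩ := ih
    have hdone : doneCount e k (j + 1) ≤ (tasks s e k ++ new).length := by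
      have hlen := congrArg List.length heq
      rw [length_tasks h, List.length_drop] at hlen
      have := (h (k + j)).done_le
      rw [doneCount_succ]
      omega
    refine ⟨new ++ if enters (s (k + j)) (e (k + j)) then [k + j + 1] else [], ?_, ?_, ?_⟩
    · intro a ha
      rcases List.mem_append.1 ha with ha | ha
      · exact hnew a ha
      · split_ifs at ha
        · rw [List.mem_singleton.1 ha, add_assoc]
          exact Nat.lt_add_of_pos_right j.succ_pos
        · exact absurd ha List.not_mem_nil
    · rw [← add_assoc, tasks_succ h, heq, List.drop_drop, ← doneCount_succ, ← List.append_assoc,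
        List.drop_append_of_le_length hdone]
    · rw [← List.append_assoc, List.length_append]
      exact hdone.trans (Nat.le_add_right _ _)

theorem le_of_mem_tasks {k a : ℕ} (ha : a ∈ tasks s e k) : a ≤ k := by
  induction k with
  | zero =>
    simp only [tasks, contents, List.mem_append, List.mem_replicate] at ha
    omega
  | succ k ih =>
    have hsub : a ∈ tasks s e k ∨ a = k + 1 := by
      simp only [tasks, contents, List.mem_append] at ha ⊢
      rcases ha with (ha | ha) | (ha | ha) <;> split_ifs at ha
      · exact .inl (.inl (List.mem_of_mem_tail ha))
      · exact .inl (.inl ha)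
      · exact .inl (.inr (List.mem_of_mem_take ha))
      · exact absurd ha List.not_mem_nil
      · exact .inl (.inr (List.mem_of_mem_tail ha))
      · exact .inl (.inr ha)
      · exact .inr (List.mem_singleton.1 ha)
      · exact absurd ha List.not_mem_nil
    rcases hsub with ha | rfl
    · exact Nat.le_succ_of_le (ih ha)
    · exact le_rfl

theorem completes_iff (h : ∀ k, IsFeasible (s k) (e k) (s (k + 1))) {k : ℕ}
    (hk : enters (s k) (e k) = true) (j : ℕ) :
    completes s e (k + 1 + j) (k + 1) ↔ (e (k + 1 + j)).done = true ∧
      doneCount e (k + 1) j + 1 = (s (k + 1)).i₁ + (s (k + 1)).i₂ := by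
  refine and_congr_right fun hdone ↦ ?_
  have hne : (contents s e (k + 1 + j)).2 ≠ [] := by
    have := (h (k + 1 + j)).done_le
    rw [← (length_contents h _).2, hdone] at this
    exact List.ne_nil_of_length_pos this
  obtain ⟨new, hnew, heq, -⟩ := exists_tasks_add_eq_drop h (k + 1) j
  have htasks := tasks_succ h k
  rw [if_pos hk] at htasks
  have hlen := length_tasks h (k + 1)
  rw [htasks, List.length_append, List.length_singleton] at hlen
  rw [← List.head?_append_of_ne_nil _ hne, ← tasks, heq, htasks, List.append_assoc,
    List.singleton_append, List.head?_drop, getElem?_append_cons_eq_some_iff, ← hlen, add_left_inj]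
  · exact fun hmem ↦ absurd (le_of_mem_tasks (List.mem_of_mem_drop hmem)) (by omega)
  · exact fun hmem ↦ lt_irrefl _ (hnew _ hmem)

theorem delay_le_iff_exists_completes (s : ℕ → State m n₁ n₂ l N₁ N₂) (e : ℕ → Slot) (k n : ℕ) :
    delay s e k ≤ n ↔ ∃ j < n, completes s e (k + 1 + j) (k + 1) := by
  have hzero : ¬ completes s e k (k + 1) := fun h ↦ absurd
    (le_of_mem_tasks (List.mem_append_left _ (List.mem_of_head? h.2))) (Nat.not_succ_le_self k)
  simp only [delay, ← ENat.lt_add_one_iff (ENat.natCast_ne_top n), iInf_lt_iff, exists_prop]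
  norm_cast
  constructor
  · rintro ⟨_ | j, hj, hjn⟩
    · exact absurd hj hzero
    · exact ⟨j, by omega, by rwa [add_assoc, add_comm 1]⟩
  · rintro ⟨j, hjn, hj⟩
    exact ⟨j + 1, by rwa [add_comm j, ← add_assoc], by omega⟩

theorem delay_le_iff (h : ∀ k, IsFeasible (s k) (e k) (s (k + 1))) {k : ℕ}
    (hk : enters (s k) (e k) = true) (n : ℕ) :
    delay s e k ≤ n ↔ ((s (k + 1)).i₁ + (s (k + 1)).i₂ : ℕ) ≤ doneCount e (k + 1) n := by
  have hpos : 0 < ((s (k + 1)).i₁ + (s (k + 1)).i₂ : ℕ) := by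
    rw [← length_tasks h, tasks_succ h, if_pos hk, List.length_append, List.length_singleton]
    exact Nat.succ_pos _
  obtain ⟨r, hr⟩ := Nat.exists_eq_add_of_lt hpos
  rw [zero_add] at hr
  simp only [delay_le_iff_exists_completes, completes_iff h hk, hr, add_left_inj,
    exists_done_and_doneCount_eq_iff, Nat.succ_le_iff]

end Fifo

section Kernel

variable {m n₁ n₂ l N₁ N₂ : ℕ}

/-- The entries of the arrival matrix `D₁` or `D₀` that belongs to the slots with, respectively
without, a generated task. -/
def Params.arrivalProb (Q : Params m n₁ n₂ l) (a : Bool) (i j : Fin m) : ℝ :=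
  (if a then Q.D₁ else Q.D₀) i j

/-- The transition kernel of server 1, restricted to the new phases that are idle exactly if the
flag `idle` is set. The flag says whether queue 1 is empty at the end of the slot. -/
def Params.kernel₁ (Q : Params m n₁ n₂ l) (idle full : Bool) (p : Option (Fin l ⊕ Fin n₁))
    (sent : Bool) (p' : Option (Fin l ⊕ Fin n₁)) : ℝ :=
  if p'.isNone = idle then Q.server₁ full p sent p' else 0

/-- The transition kernel of server 2, restricted to the new phases that are idle exactly if the
flag `idle` is set. The flag says whether queue 2 is empty at the end of the slot. -/
def Params.kernel₂ (Q : Params m n₁ n₂ l) (idle : Bool) (p : Option (Fin n₂))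
    (done : Bool) (p' : Option (Fin n₂)) : ℝ :=
  if p'.isNone = idle then Q.server₂ p done p' else 0

/-- The probability that server 1 completes (`true`) or does not complete (`false`) a transmission
in a slot. -/
def Params.sendProb (Q : Params m n₁ n₂ l) : Option (Fin l ⊕ Fin n₁) → Bool → ℝ
  | some (Sum.inr j), true => Q.tx.exit j
  | some (Sum.inr j), false => 1 - Q.tx.exit j
  | _, true => 0
  | _, false => 1

/-- The probability that server 2 completes (`true`) or does not complete (`false`) a computation
in a slot. -/
def Params.doneProb (Q : Params m n₁ n₂ l) : Option (Fin n₂) → Bool → ℝ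
  | some j, true => Q.comp.exit j
  | some j, false => 1 - Q.comp.exit j
  | none, true => 0
  | none, false => 1

/-- The length of queue 1 after a slot. -/
def next₁ (s : State m n₁ n₂ l N₁ N₂) (e : Slot) : ℕ :=
  s.i₁ + (enters s e).toNat - e.sent.toNat

/-- The length of queue 2 after a slot, given its length `i` before the slot. -/
def next₂ (i : ℕ) (sent done : Bool) : ℕ :=
  i + sent.toNat - done.toNat

/-- The probability that a slot has the events `e` and leaves the arrival process and the two
servers in the phases `h`, `p₁` and `p₂`. -/
def Params.phaseStep (Q : Params m n₁ n₂ l) (s : State m n₁ n₂ l N₁ N₂) (e : Slot) (h : Fin m)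
    (p₁ : Option (Fin l ⊕ Fin n₁)) (p₂ : Option (Fin n₂)) : ℝ :=
  Q.arrivalProb e.arrival s.ph h *
    Q.kernel₁ (decide (next₁ s e = 0)) (decide (next₂ s.i₂ e.sent e.done = N₂)) s.p₁ e.sent p₁ *
    Q.kernel₂ (decide (next₂ s.i₂ e.sent e.done = 0)) s.p₂ e.done p₂

/-- The part of `Params.IsValid` that makes the transition probabilities sum to one; unlike
`Params.IsValid` it is inherited by the system without arrivals. -/
structure Params.IsStochastic (Q : Params m n₁ n₂ l) : Prop where
  tx_init : ∑ j, Q.tx.init j = 1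
  comp_init : ∑ j, Q.comp.init j = 1
  vac_init : ∑ j, Q.vac.init j = 1
  arrival : ∀ i, ∑ a, ∑ j, Q.arrivalProb a i j = 1

theorem Params.IsValid.isStochastic {Q : Params m n₁ n₂ l} (hQ : Q.IsValid) : Q.IsStochastic where
  tx_init := hQ.tx.init_sum
  comp_init := hQ.comp.init_sum
  vac_init := hQ.vac.init_sum
  arrival i := by
    simp [← hQ.dmap.row_sum i, Params.arrivalProb, Finset.sum_add_distrib, add_comm]

theorem Params.IsStochastic.noArrivals {Q : Params m n₁ n₂ l} (hQ : Q.IsStochastic) :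
    Q.noArrivals.IsStochastic where
  tx_init := hQ.tx_init
  comp_init := hQ.comp_init
  vac_init := hQ.vac_init
  arrival i := by simp [Params.arrivalProb, Params.noArrivals, Matrix.one_apply]

theorem Params.IsStochastic.sum_arrival_mul {Q : Params m n₁ n₂ l} (hQ : Q.IsStochastic)
    (i : Fin m) (c : ℝ) : ∑ a, (∑ j, Q.arrivalProb a i j) * c = c :=
  (Finset.sum_mul ..).symm.trans (by rw [hQ.arrival i, one_mul])

theorem sum_sendProb (Q : Params m n₁ n₂ l) (p : Option (Fin l ⊕ Fin n₁)) :
    ∑ b, Q.sendProb p b = 1 := by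
  rcases p with _ | _ | _ <;> simp [Params.sendProb]

theorem sum_doneProb (Q : Params m n₁ n₂ l) (p : Option (Fin n₂)) :
    ∑ d, Q.doneProb p d = 1 := by
  rcases p with _ | _ <;> simp [Params.doneProb]

theorem sum_start₁ {Q : Params m n₁ n₂ l} (hQ : Q.IsStochastic) (idle full : Bool) :
    ∑ p, (if p.isNone = idle then Q.start₁ full p else 0) = 1 := by
  cases idle <;> cases full <;>
    simp [Fintype.sum_option, Params.start₁, hQ.tx_init, hQ.vac_init]

theorem sum_start₂ {Q : Params m n₁ n₂ l} (hQ : Q.IsStochastic) (idle : Bool) :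
    ∑ p, (if p.isNone = idle then Q.start₂ p else 0) = 1 := by
  cases idle <;> simp [Fintype.sum_option, Params.start₂, hQ.comp_init]

theorem sum_kernel₁ {Q : Params m n₁ n₂ l} (hQ : Q.IsStochastic) {idle : Bool} (full : Bool)
    {p : Option (Fin l ⊕ Fin n₁)} {sent : Bool} (h : p ≠ none → sent = false → idle = false) :
    ∑ p', Q.kernel₁ idle full p sent p' = Q.sendProb p sent := by
  have hstart := sum_start₁ hQ idle full
  rcases p with _ | j | j <;> cases sent
  · exact hstart
  · simp [Params.kernel₁, Params.server₁, Params.sendProb]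
  · obtain rfl := h (Option.some_ne_none _) rfl
    have hnew : ∑ p, Q.start₁ full (some p) = 1 := by
      simpa [Fintype.sum_option] using hstart
    have hvac (i : Fin l) : Q.server₁ full (some (.inl j)) false (some (.inl i)) =
        Q.vac.trans j i + Q.vac.exit j * Q.start₁ full (some (.inl i)) := rfl
    have htx (i : Fin n₁) : Q.server₁ full (some (.inl j)) false (some (.inr i)) =
        Q.vac.exit j * Q.start₁ full (some (.inr i)) := rfl
    simp only [Params.kernel₁, Fintype.sum_option, Option.isNone_none, Option.isNone_some,
      Bool.true_eq_false, if_true, if_false, zero_add, Fintype.sum_sum_type, hvac, htx,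
      Finset.sum_add_distrib, add_assoc, ← Finset.mul_sum]
    rw [← mul_add, ← Fintype.sum_sum_type fun p ↦ Q.start₁ full (some p), hnew, DPH.exit]
    simp [Params.sendProb]
  · simp [Params.kernel₁, Params.server₁, Params.sendProb]
  · obtain rfl := h (Option.some_ne_none _) rfl
    simp [Fintype.sum_option, Params.kernel₁, Params.server₁, Params.sendProb, DPH.exit]
  · rw [Params.sendProb, ← mul_one (Q.tx.exit j), ← hstart, Finset.mul_sum]
    simp only [mul_ite, mul_zero]
    rfl

theorem sum_kernel₂ {Q : Params m n₁ n₂ l} (hQ : Q.IsStochastic) {idle : Bool}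
    {p : Option (Fin n₂)} {done : Bool} (h : p ≠ none → done = false → idle = false) :
    ∑ p', Q.kernel₂ idle p done p' = Q.doneProb p done := by
  have hstart := sum_start₂ hQ idle
  rcases p with _ | j <;> cases done
  · exact hstart
  · simp [Params.kernel₂, Params.server₂, Params.doneProb]
  · obtain rfl := h (Option.some_ne_none _) rfl
    simp [Fintype.sum_option, Params.kernel₂, Params.server₂, Params.doneProb, DPH.exit]
  · rw [Params.doneProb, ← mul_one (Q.comp.exit j), ← hstart, Finset.mul_sum]
    simp only [mul_ite, mul_zero]
    rfl

theorem State.p₁_ne_none_iff {s : State m n₁ n₂ l N₁ N₂} : s.p₁ ≠ none ↔ 0 < (s.i₁ : ℕ) := by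
  rw [Ne, s.idle₁, Fin.ext_iff, Fin.val_zero, Nat.pos_iff_ne_zero]

theorem State.p₂_ne_none_iff {s : State m n₁ n₂ l N₁ N₂} : s.p₂ ≠ none ↔ 0 < (s.i₂ : ℕ) := by
  rw [Ne, s.idle₂, Fin.ext_iff, Fin.val_zero, Nat.pos_iff_ne_zero]

theorem exists_eq_inr_of_server₁_ne_zero {Q : Params m n₁ n₂ l} {full : Bool}
    {p p' : Option (Fin l ⊕ Fin n₁)} (h : Q.server₁ full p true p' ≠ 0) :
    ∃ j, p = some (Sum.inr j) := by
  rcases p with _ | j | j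
  · exact absurd rfl h
  · exact absurd rfl h
  · exact ⟨j, rfl⟩

theorem sent_le_of_server₁_ne_zero {Q : Params m n₁ n₂ l} {s : State m n₁ n₂ l N₁ N₂}
    {full sent : Bool} {p' : Option (Fin l ⊕ Fin n₁)} (h : Q.server₁ full s.p₁ sent p' ≠ 0) :
    sent.toNat ≤ (s.i₁ : ℕ) := by
  cases sent
  · exact Nat.zero_le _
  · obtain ⟨j, hj⟩ := exists_eq_inr_of_server₁_ne_zero h
    exact State.p₁_ne_none_iff.1 (hj ▸ Option.some_ne_none _)

theorem add_sent_le_of_server₁_ne_zero {Q : Params m n₁ n₂ l} {s : State m n₁ n₂ l N₁ N₂}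
    {full sent : Bool} {p' : Option (Fin l ⊕ Fin n₁)} (h : Q.server₁ full s.p₁ sent p' ≠ 0) :
    (s.i₂ : ℕ) + sent.toNat ≤ N₂ := by
  cases sent
  · exact Nat.le_of_lt_succ s.i₂.2
  · obtain ⟨j, hj⟩ := exists_eq_inr_of_server₁_ne_zero h
    exact Fin.val_lt_last fun hfull ↦ s.full hfull j hj

theorem done_le_of_server₂_ne_zero {Q : Params m n₁ n₂ l} {s : State m n₁ n₂ l N₁ N₂}
    {done : Bool} {p' : Option (Fin n₂)} (h : Q.server₂ s.p₂ done p' ≠ 0) :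
    done.toNat ≤ (s.i₂ : ℕ) := by
  cases done
  · exact Nat.zero_le _
  · refine State.p₂_ne_none_iff.1 fun hp ↦ h ?_
    rw [hp, Params.server₂]

theorem next₁_le {s : State m n₁ n₂ l N₁ N₂} {e : Slot} (hsent : e.sent.toNat ≤ (s.i₁ : ℕ)) :
    next₁ s e ≤ N₁ := by
  have hroom (ha : enters s e = true) (hs : e.sent = false) : (s.i₁ : ℕ) < N₁ := by
    simpa only [hs, Bool.or_false, decide_eq_true_eq] using (Bool.and_eq_true_iff.1 ha).2
  have := s.i₁.2
  unfold next₁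
  cases ha : enters s e <;> cases hs : e.sent <;>
    simp only [ha, hs, Bool.toNat_true, Bool.toNat_false, forall_true_left] at * <;> omega

theorem ne_inr_of_next₂_eq {Q : Params m n₁ n₂ l} {s : State m n₁ n₂ l N₁ N₂} {sent done : Bool}
    {p' : Option (Fin l ⊕ Fin n₁)} (hfull : next₂ s.i₂ sent done = N₂)
    (h : Q.server₁ true s.p₁ sent p' ≠ 0) (j : Fin n₁) : p' ≠ some (Sum.inr j) := by
  rintro rfl
  cases sent
  · have hs : s.i₂ = Fin.last N₂ := Fin.ext <| by
      have := s.i₂.2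
      simp only [next₂, Bool.toNat_false] at hfull
      simp only [Fin.val_last]
      omega
    rcases hp : s.p₁ with _ | i | i
    · simp [hp, Params.server₁, Params.start₁] at h
    · simp [hp, Params.server₁, Params.start₁] at h
    · exact s.full hs i hp
  · obtain ⟨i, hi⟩ := exists_eq_inr_of_server₁_ne_zero h
    simp [hi, Params.server₁, Params.start₁] at h

theorem isFeasible_of_step_ne_zero {Q : Params m n₁ n₂ l} {s s' : State m n₁ n₂ l N₁ N₂} {e : Slot}
    (h : Q.step s e s' ≠ 0) : IsFeasible s e s' := by
  unfold Params.step at h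
  obtain ⟨hadd, h⟩ := ite_ne_right_iff.1 h
  simp only [ne_eq, mul_eq_zero, not_or] at h
  exact ⟨sent_le_of_server₁_ne_zero h.1.2, done_le_of_server₂_ne_zero h.2, hadd.1, hadd.2⟩

theorem isNone_eq_decide_iff {α : Type*} {p : Option α} {i : ℕ} :
    p.isNone = decide (i = 0) ↔ (p = none ↔ i = 0) := by
  rw [Bool.eq_iff_iff, Option.isNone_iff_eq_none, decide_eq_true_iff]

theorem IsFeasible.step_eq_phaseStep {s s' : State m n₁ n₂ l N₁ N₂} {e : Slot}
    (h : IsFeasible s e s') (Q : Params m n₁ n₂ l) :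
    Q.step s e s' = Q.phaseStep s e s'.ph s'.p₁ s'.p₂ := by
  have h₁ : next₁ s e = s'.i₁ := by rw [next₁, ← h.i₁_add, Nat.add_sub_cancel]
  have h₂ : next₂ s.i₂ e.sent e.done = s'.i₂ := by rw [next₂, ← h.i₂_add, Nat.add_sub_cancel]
  have hfull : (s'.i₂ : ℕ) = N₂ ↔ s'.i₂ = Fin.last N₂ := by rw [Fin.ext_iff, Fin.val_last]
  have hidle₁ : s'.p₁.isNone = decide ((s'.i₁ : ℕ) = 0) := by
    rw [isNone_eq_decide_iff, s'.idle₁, Fin.ext_iff, Fin.val_zero]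
  have hidle₂ : s'.p₂.isNone = decide ((s'.i₂ : ℕ) = 0) := by
    rw [isNone_eq_decide_iff, s'.idle₂, Fin.ext_iff, Fin.val_zero]
  simp only [Params.step, Params.phaseStep, Params.arrivalProb, Params.kernel₁, Params.kernel₂,
    h.i₁_add, h.i₂_add, h₁, h₂, hidle₁, hidle₂, hfull, and_self, if_true]

theorem exists_isFeasible_of_phaseStep_ne_zero {Q : Params m n₁ n₂ l}
    {s : State m n₁ n₂ l N₁ N₂} {e : Slot} {h : Fin m} {p₁ : Option (Fin l ⊕ Fin n₁)}
    {p₂ : Option (Fin n₂)} (hstep : Q.phaseStep s e h p₁ p₂ ≠ 0) :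
    ∃ s' : State m n₁ n₂ l N₁ N₂, IsFeasible s e s' ∧ (s'.ph, s'.p₁, s'.p₂) = (h, p₁, p₂) := by
  simp only [Params.phaseStep, Params.kernel₁, Params.kernel₂, ne_eq, mul_eq_zero, not_or,
    ite_eq_right_iff, Classical.not_imp, isNone_eq_decide_iff] at hstep
  obtain ⟨⟨-, hidle₁, hserver₁⟩, hidle₂, hserver₂⟩ := hstep
  have hsent := sent_le_of_server₁_ne_zero hserver₁
  have hsent' := add_sent_le_of_server₁_ne_zero hserver₁
  have hdone := done_le_of_server₂_ne_zero hserver₂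
  refine ⟨{
    i₁ := ⟨next₁ s e, Nat.lt_succ_of_le (next₁_le hsent)⟩
    i₂ := ⟨next₂ s.i₂ e.sent e.done, Nat.lt_succ_of_le ((Nat.sub_le _ _).trans hsent')⟩
    ph := h
    p₁ := p₁
    p₂ := p₂
    idle₁ := by rw [hidle₁, Fin.ext_iff, Fin.val_zero]
    idle₂ := by rw [hidle₂, Fin.ext_iff, Fin.val_zero]
    full := fun hfull ↦ ?_ }, ⟨hsent, hdone, ?_, ?_⟩, rfl⟩
  · have hlast : next₂ s.i₂ e.sent e.done = N₂ := congrArg Fin.val hfull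
    rw [decide_eq_true hlast] at hserver₁
    exact ne_inr_of_next₂_eq hlast hserver₁
  · exact Nat.sub_add_cancel (Nat.le_add_right_of_le hsent)
  · exact Nat.sub_add_cancel (Nat.le_add_right_of_le hdone)

theorem sum_step_mul (Q : Params m n₁ n₂ l) (s : State m n₁ n₂ l N₁ N₂) (e : Slot)
    (G : Fin m → Option (Fin l ⊕ Fin n₁) → Option (Fin n₂) → ℝ) :
    ∑ s', Q.step s e s' * G s'.ph s'.p₁ s'.p₂ =
      ∑ h, ∑ p₁, ∑ p₂, Q.phaseStep s e h p₁ p₂ * G h p₁ p₂ := by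
  simp only [← Fintype.sum_prod_type']
  have hfeas (s') (h : Q.step s e s' * G s'.ph s'.p₁ s'.p₂ ≠ 0) : IsFeasible s e s' :=
    isFeasible_of_step_ne_zero (left_ne_zero_of_mul h)
  refine Finset.sum_bij_ne_zero (fun s' _ _ ↦ (s'.ph, s'.p₁, s'.p₂)) ?_ ?_ ?_ ?_
  · exact fun _ _ _ ↦ Finset.mem_univ _
  · intro a _ ha b _ hb hab
    obtain ⟨-, -, ha₁, ha₂⟩ := hfeas a ha
    obtain ⟨-, -, hb₁, hb₂⟩ := hfeas b hb
    cases a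
    cases b
    simp only [Prod.mk.injEq] at hab ha₁ ha₂ hb₁ hb₂
    simp only [State.mk.injEq, Fin.ext_iff, hab, and_true]
    omega
  · rintro ⟨h, p₁, p₂⟩ _ hne
    obtain ⟨s', hs', heq⟩ := exists_isFeasible_of_phaseStep_ne_zero (left_ne_zero_of_mul hne)
    obtain ⟨rfl, rfl, rfl⟩ := by simpa only [Prod.mk.injEq] using heq
    exact ⟨s', Finset.mem_univ _, hs'.step_eq_phaseStep Q ▸ hne, rfl⟩
  · intro s' _ hs'
    rw [(hfeas s' hs').step_eq_phaseStep]

theorem sum_step_mul_mul (Q : Params m n₁ n₂ l) (s : State m n₁ n₂ l N₁ N₂) (e : Slot)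
    (f : Fin m → ℝ) (G : Option (Fin l ⊕ Fin n₁) → Option (Fin n₂) → ℝ) :
    ∑ s', Q.step s e s' * (f s'.ph * G s'.p₁ s'.p₂) =
      (∑ h, Q.arrivalProb e.arrival s.ph h * f h) *
        ∑ p₁, Q.kernel₁ (decide (next₁ s e = 0)) (decide (next₂ s.i₂ e.sent e.done = N₂))
          s.p₁ e.sent p₁ *
        ∑ p₂, Q.kernel₂ (decide (next₂ s.i₂ e.sent e.done = 0)) s.p₂ e.done p₂ * G p₁ p₂ := by
  rw [sum_step_mul Q s e fun h p₁ p₂ ↦ f h * G p₁ p₂, Finset.sum_mul_sum]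
  simp only [Finset.mul_sum, Params.phaseStep]
  refine Finset.sum_congr rfl fun h _ ↦ Finset.sum_congr rfl fun p₁ _ ↦
    Finset.sum_congr rfl fun p₂ _ ↦ ?_
  ring

theorem sum_slot (f : Slot → ℝ) : ∑ e, f e = ∑ a, ∑ b, ∑ d, f ⟨a, b, d⟩ := by
  let toProd : Slot ≃ Bool × Bool × Bool :=
    ⟨fun e ↦ (e.arrival, e.sent, e.done), fun q ↦ ⟨q.1, q.2.1, q.2.2⟩, fun _ ↦ rfl, fun _ ↦ rfl⟩
  simp only [← Fintype.sum_prod_type']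
  exact Fintype.sum_equiv toProd _ _ fun _ ↦ rfl

theorem next₁_ne_zero {s : State m n₁ n₂ l N₁ N₂} {e : Slot} (hp : s.p₁ ≠ none)
    (hsent : e.sent = false) : next₁ s e ≠ 0 := by
  rw [next₁, hsent]
  exact (Nat.add_pos_left (State.p₁_ne_none_iff.1 hp) _).ne'

theorem next₂_ne_zero {i : ℕ} (hi : 0 < i) (sent : Bool) : next₂ i sent false ≠ 0 :=
  (Nat.add_pos_left hi _).ne'

theorem sum_kernel₁_next {Q : Params m n₁ n₂ l} (hQ : Q.IsStochastic)
    (s : State m n₁ n₂ l N₁ N₂) (e : Slot) (full : Bool) :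
    ∑ p₁, Q.kernel₁ (decide (next₁ s e = 0)) full s.p₁ e.sent p₁ = Q.sendProb s.p₁ e.sent :=
  sum_kernel₁ hQ full fun hp hsent ↦ decide_eq_false (next₁_ne_zero hp hsent)

theorem sum_kernel₂_next {Q : Params m n₁ n₂ l} (hQ : Q.IsStochastic)
    (s : State m n₁ n₂ l N₁ N₂) (e : Slot) :
    ∑ p₂, Q.kernel₂ (decide (next₂ s.i₂ e.sent e.done = 0)) s.p₂ e.done p₂ =
      Q.doneProb s.p₂ e.done :=
  sum_kernel₂ hQ fun hp hdone ↦ decide_eq_false <|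
    hdone ▸ next₂_ne_zero (State.p₂_ne_none_iff.1 hp) e.sent

theorem sum_step_mul_ph {Q : Params m n₁ n₂ l} (hQ : Q.IsStochastic) (s : State m n₁ n₂ l N₁ N₂)
    (e : Slot) (f : Fin m → ℝ) :
    ∑ s', Q.step s e s' * f s'.ph =
      (∑ h, Q.arrivalProb e.arrival s.ph h * f h) *
        (Q.sendProb s.p₁ e.sent * Q.doneProb s.p₂ e.done) := by
  simpa only [mul_one, ← Finset.sum_mul, sum_kernel₁_next hQ, sum_kernel₂_next hQ] using
    sum_step_mul_mul Q s e f fun _ _ ↦ 1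

theorem sum_step_mul_p₁ {Q : Params m n₁ n₂ l} (hQ : Q.IsStochastic) (s : State m n₁ n₂ l N₁ N₂)
    (e : Slot) (f : Option (Fin l ⊕ Fin n₁) → ℝ) :
    ∑ s', Q.step s e s' * f s'.p₁ =
      (∑ h, Q.arrivalProb e.arrival s.ph h) *
        ((∑ p₁, Q.kernel₁ (decide (next₁ s e = 0)) (decide (next₂ s.i₂ e.sent e.done = N₂))
          s.p₁ e.sent p₁ * f p₁) * Q.doneProb s.p₂ e.done) := by
  simpa only [one_mul, mul_one, ← Finset.sum_mul, sum_kernel₂_next hQ,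
    mul_comm (Q.doneProb _ _), ← mul_assoc] using
    sum_step_mul_mul Q s e (fun _ ↦ 1) fun p₁ _ ↦ f p₁

theorem sum_step_mul_p₂ {Q : Params m n₁ n₂ l} (hQ : Q.IsStochastic) (s : State m n₁ n₂ l N₁ N₂)
    (e : Slot) (f : Option (Fin n₂) → ℝ) :
    ∑ s', Q.step s e s' * f s'.p₂ =
      (∑ h, Q.arrivalProb e.arrival s.ph h) * (Q.sendProb s.p₁ e.sent *
        ∑ p₂, Q.kernel₂ (decide (next₂ s.i₂ e.sent e.done = 0)) s.p₂ e.done p₂ * f p₂) := by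
  simpa only [one_mul, mul_one, ← Finset.sum_mul, sum_kernel₁_next hQ] using
    sum_step_mul_mul Q s e (fun _ ↦ 1) fun _ p₂ ↦ f p₂

theorem sum_step_arrival_ph {Q : Params m n₁ n₂ l} (hQ : Q.IsStochastic)
    (s : State m n₁ n₂ l N₁ N₂) (g : Bool → Fin m → ℝ) :
    ∑ e, ∑ s', Q.step s e s' * g e.arrival s'.ph =
      ∑ a, ∑ h, Q.arrivalProb a s.ph h * g a h := by
  simp only [sum_step_mul_ph hQ s _ (g _), sum_slot, ← Finset.mul_sum, sum_doneProb, mul_one,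
    sum_sendProb]

theorem sum_step {Q : Params m n₁ n₂ l} (hQ : Q.IsStochastic) (s : State m n₁ n₂ l N₁ N₂) :
    ∑ e, ∑ s', Q.step s e s' = 1 := by
  simpa only [mul_one, hQ.arrival] using sum_step_arrival_ph hQ s fun _ _ ↦ 1

end Kernel

section Tagged

theorem tailProb_zero {S B : Type*} [Fintype S] [Fintype B] {κ : S → B → S → ℝ}
    (hκ : ∀ s, ∑ e, ∑ s', κ s e s' = 1) (w : B → ℕ) (n : ℕ) (s : S) : tailProb κ w n s 0 = 1 := by
  induction n generalizing s with
  | zero => rfl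
  | succ n ih => simp only [tailProb, Nat.zero_sub, ih, mul_one, hκ]

variable {m n₁ n₂ l N₁ N₂ : ℕ}

/-- The probability that a server 2 that does not run out of tasks completes at least `r`
computations in `n` slots, starting from the given phase. -/
def Params.drainProb (Q : Params m n₁ n₂ l) : ℕ → ℕ → Option (Fin n₂) → ℝ
  | _, 0, _ => 1
  | 0, _ + 1, _ => 0
  | n + 1, r + 1, p => ∑ d, ∑ p', Q.kernel₂ false p d p' * Q.drainProb n (r + 1 - d.toNat) p'

/-- The probability that a server 1 that does not run out of tasks and server 2 behind it complete
at least `r` computations in `n` slots, starting with `i` tasks in queue 2, whose capacity is `N`,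
and from the given phases. -/
def Params.taggedProb (Q : Params m n₁ n₂ l) (N : ℕ) :
    ℕ → ℕ → ℕ → Option (Fin l ⊕ Fin n₁) → Option (Fin n₂) → ℝ
  | _, 0, _, _, _ => 1
  | 0, _ + 1, _, _, _ => 0
  | n + 1, r + 1, i, p₁, p₂ => ∑ b, ∑ d,
      ∑ p₁', Q.kernel₁ false (decide (next₂ i b d = N)) p₁ b p₁' *
        ∑ p₂', Q.kernel₂ (decide (next₂ i b d = 0)) p₂ d p₂' *
          Q.taggedProb N n (r + 1 - d.toNat) (next₂ i b d) p₁' p₂'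

theorem drainProb_zero (Q : Params m n₁ n₂ l) (n : ℕ) (p : Option (Fin n₂)) :
    Q.drainProb n 0 p = 1 := by
  cases n <;> rfl

theorem taggedProb_zero (Q : Params m n₁ n₂ l) (N n i : ℕ) (p₁ : Option (Fin l ⊕ Fin n₁))
    (p₂ : Option (Fin n₂)) : Q.taggedProb N n 0 i p₁ p₂ = 1 := by
  cases n <;> rfl

theorem sum_kernel₁_mul_eq {Q : Params m n₁ n₂ l} (hQ : Q.IsStochastic) {idle : Bool} (full : Bool)
    {p : Option (Fin l ⊕ Fin n₁)} {sent : Bool} (h : p ≠ none → sent = false → idle = false)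
    {f : Option (Fin l ⊕ Fin n₁) → ℝ} {c : ℝ} (hf : idle = true → ∀ p', f p' = c) :
    ∑ p', Q.kernel₁ idle full p sent p' * f p' = ∑ p', Q.kernel₁ false full p sent p' * f p' := by
  cases idle
  · rfl
  · simp only [hf rfl, ← Finset.sum_mul, sum_kernel₁ hQ full h,
      sum_kernel₁ hQ full fun _ _ ↦ rfl]

theorem sum_kernel₂_mul_eq {Q : Params m n₁ n₂ l} (hQ : Q.IsStochastic) {idle : Bool}
    {p : Option (Fin n₂)} {done : Bool} (h : p ≠ none → done = false → idle = false)
    {f : Option (Fin n₂) → ℝ} {c : ℝ} (hf : idle = true → ∀ p', f p' = c) :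
    ∑ p', Q.kernel₂ idle p done p' * f p' = ∑ p', Q.kernel₂ false p done p' * f p' := by
  cases idle
  · rfl
  · simp only [hf rfl, ← Finset.sum_mul, sum_kernel₂ hQ h, sum_kernel₂ hQ fun _ _ ↦ rfl]

theorem taggedProb_eq_drainProb {Q : Params m n₁ n₂ l} (hQ : Q.IsStochastic) {N n r i : ℕ}
    (hr : r ≤ i) (p₁ : Option (Fin l ⊕ Fin n₁)) (p₂ : Option (Fin n₂)) :
    Q.taggedProb N n r i p₁ p₂ = Q.drainProb n r p₂ := by
  induction n generalizing r i p₁ p₂ with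
  | zero => cases r <;> rfl
  | succ n ih =>
    rcases r with _ | r
    · rw [taggedProb_zero, drainProb_zero]
    have hrest (b d : Bool) : r + 1 - d.toNat ≤ next₂ i b d := by
      rw [next₂]
      omega
    have hsaturated (b d : Bool) : ∑ p₂', Q.kernel₂ (decide (next₂ i b d = 0)) p₂ d p₂' *
        Q.drainProb n (r + 1 - d.toNat) p₂' =
          ∑ p₂', Q.kernel₂ false p₂ d p₂' * Q.drainProb n (r + 1 - d.toNat) p₂' := by
      refine sum_kernel₂_mul_eq hQ (c := 1) ?_ fun hempty p ↦ ?_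
      · rintro - rfl
        exact decide_eq_false (next₂_ne_zero (by omega) b)
      · have := hrest b d
        rw [of_decide_eq_true hempty, Nat.le_zero] at this
        rw [this, drainProb_zero]
    simp only [Params.taggedProb, ih (hrest _ _), hsaturated, ← Finset.sum_mul,
      sum_kernel₁ hQ _ fun _ _ ↦ rfl, ← Finset.mul_sum, sum_sendProb, one_mul, Params.drainProb]

theorem taggedProb_noArrivals (Q : Params m n₁ n₂ l) (N n r i : ℕ) (p₁ : Option (Fin l ⊕ Fin n₁))
    (p₂ : Option (Fin n₂)) :
    Q.noArrivals.taggedProb N n r i p₁ p₂ = Q.taggedProb N n r i p₁ p₂ := by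
  induction n generalizing r i p₁ p₂ with
  | zero => cases r <;> rfl
  | succ n ih =>
    cases r with
    | zero => rfl
    | succ r =>
      simp only [Params.taggedProb, ih]
      rfl

theorem sum_step_mul_taggedProb {Q : Params m n₁ n₂ l} (hQ : Q.IsStochastic)
    (s : State m n₁ n₂ l N₁ N₂) (a b d : Bool) {n r : ℕ} (hr : r ≤ (s.i₁ + s.i₂ : ℕ)) :
    ∑ s' : State m n₁ n₂ l N₁ N₂, Q.step s ⟨a, b, d⟩ s' *
        Q.taggedProb N₂ n (r - d.toNat) s'.i₂ s'.p₁ s'.p₂ =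
      (∑ h, Q.arrivalProb a s.ph h) *
        ∑ p₁, Q.kernel₁ false (decide (next₂ s.i₂ b d = N₂)) s.p₁ b p₁ *
          ∑ p₂, Q.kernel₂ (decide (next₂ s.i₂ b d = 0)) s.p₂ d p₂ *
            Q.taggedProb N₂ n (r - d.toNat) (next₂ s.i₂ b d) p₁ p₂ := by
  have hnext (s' : State m n₁ n₂ l N₁ N₂) :
      Q.step s ⟨a, b, d⟩ s' * Q.taggedProb N₂ n (r - d.toNat) s'.i₂ s'.p₁ s'.p₂ =
        Q.step s ⟨a, b, d⟩ s' *
          (1 * Q.taggedProb N₂ n (r - d.toNat) (next₂ s.i₂ b d) s'.p₁ s'.p₂) := by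
    by_cases hs' : Q.step s ⟨a, b, d⟩ s' = 0
    · simp only [hs', zero_mul]
    · rw [next₂, ← (isFeasible_of_step_ne_zero hs').i₂_add, Nat.add_sub_cancel, one_mul]
  simp only [hnext, sum_step_mul_mul Q s _ (fun _ ↦ 1), mul_one]
  congr 1
  refine sum_kernel₁_mul_eq hQ _ (fun hp hsent ↦ decide_eq_false (next₁_ne_zero hp hsent))
    (c := ∑ p₂, Q.kernel₂ (decide (next₂ s.i₂ b d = 0)) s.p₂ d p₂ *
      Q.drainProb n (r - d.toNat) p₂) fun hempty p₁ ↦ ?_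
  have hrest : r - d.toNat ≤ next₂ s.i₂ b d := by
    have := of_decide_eq_true hempty
    simp only [next₁, next₂] at this ⊢
    omega
  simp only [taggedProb_eq_drainProb hQ hrest]

/-- Tasks that arrive later do not matter for the first `r` computations: queue 1 can run empty
before them only when all the remaining ones of these tasks are in queue 2 already, and then server
1 does not matter either. -/
theorem tailProb_step_eq_taggedProb {Q : Params m n₁ n₂ l} (hQ : Q.IsStochastic) (n : ℕ)
    (s : State m n₁ n₂ l N₁ N₂) {r : ℕ} (hr : r ≤ (s.i₁ + s.i₂ : ℕ)) :
    tailProb Q.step (·.done.toNat) n s r = Q.taggedProb N₂ n r s.i₂ s.p₁ s.p₂ := by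
  induction n generalizing s r with
  | zero => cases r <;> rfl
  | succ n ih =>
    rcases r with _ | r
    · rw [tailProb_zero (sum_step hQ), taggedProb_zero]
    have hnext (e : Slot) (s' : State m n₁ n₂ l N₁ N₂) :
        Q.step s e s' * tailProb Q.step (·.done.toNat) n s' (r + 1 - e.done.toNat) =
          Q.step s e s' * Q.taggedProb N₂ n (r + 1 - e.done.toNat) s'.i₂ s'.p₁ s'.p₂ := by
      by_cases hs' : Q.step s e s' = 0
      · simp only [hs', zero_mul]
      · obtain ⟨-, -, h₁, h₂⟩ := isFeasible_of_step_ne_zero hs'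
        rw [ih s' (by omega)]
    rw [tailProb, sum_slot]
    simp only [hnext, sum_step_mul_taggedProb hQ s _ _ _ hr]
    simp only [← Finset.mul_sum, hQ.sum_arrival_mul, Params.taggedProb]

theorem tailProb_noArrivals {Q : Params m n₁ n₂ l} (hQ : Q.IsStochastic) (n : ℕ)
    (s : State m n₁ n₂ l N₁ N₂) {r : ℕ} (hr : r ≤ (s.i₁ + s.i₂ : ℕ)) :
    tailProb Q.noArrivals.step (·.done.toNat) n s r = tailProb Q.step (·.done.toNat) n s r := by
  rw [tailProb_step_eq_taggedProb hQ.noArrivals n s hr, tailProb_step_eq_taggedProb hQ n s hr,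
    taggedProb_noArrivals]

theorem arrival_eq_false_of_step_noArrivals_ne_zero {Q : Params m n₁ n₂ l}
    {s s' : State m n₁ n₂ l N₁ N₂} {e : Slot} (h : Q.noArrivals.step s e s' ≠ 0) :
    e.arrival = false := by
  refine Bool.eq_false_of_not_eq_true fun ha ↦ h ?_
  simp only [Params.step, Params.noArrivals, ha, if_true, Matrix.zero_apply, zero_mul, ite_self]

theorem noArrivals_P_mulVec_tailProb (Q : Params m n₁ n₂ l) (n : ℕ) :
    (Q.noArrivals.P N₁ N₂ *ᵥ fun s ↦
        tailProb Q.noArrivals.step (·.done.toNat) n s (s.i₁ + s.i₂)) =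
      fun s ↦ tailProb Q.noArrivals.step (·.done.toNat) (n + 1) s (s.i₁ + s.i₂) := by
  funext s
  have hnext (e : Slot) (s' : State m n₁ n₂ l N₁ N₂) :
      Q.noArrivals.step s e s' *
          tailProb Q.noArrivals.step (·.done.toNat) n s' (s'.i₁ + s'.i₂) =
        Q.noArrivals.step s e s' *
          tailProb Q.noArrivals.step (·.done.toNat) n s' (s.i₁ + s.i₂ - e.done.toNat) := by
    by_cases hs' : Q.noArrivals.step s e s' = 0
    · simp only [hs', zero_mul]
    · obtain ⟨-, -, h₁, h₂⟩ := isFeasible_of_step_ne_zero hs'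
      have hout : (enters s e).toNat = 0 := by
        rw [enters, arrival_eq_false_of_step_noArrivals_ne_zero hs', Bool.false_and,
          Bool.toNat_false]
      congr 2
      omega
  simp only [Matrix.mulVec, dotProduct, Params.P, Finset.sum_mul, hnext, tailProb]
  exact Finset.sum_comm

theorem xTilde_dotProduct_tailProb (Q : Params m n₁ n₂ l) (x : State m n₁ n₂ l N₁ N₂ → ℝ)
    (n j : ℕ) :
    (Q.xTilde x n ⬝ᵥ fun s ↦ tailProb Q.noArrivals.step (·.done.toNat) j s (s.i₁ + s.i₂)) =
      Q.z x ⬝ᵥ fun s ↦ tailProb Q.noArrivals.step (·.done.toNat) (j + n) s (s.i₁ + s.i₂) := by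
  induction n generalizing j with
  | zero => rfl
  | succ n ih =>
    rw [Params.xTilde, ← Matrix.dotProduct_mulVec, noArrivals_P_mulVec_tailProb, ih,
      Nat.add_right_comm, Nat.add_assoc]

theorem emptyMass_eq_dotProduct (Q : Params m n₁ n₂ l) (y : State m n₁ n₂ l N₁ N₂ → ℝ) :
    emptyMass y =
      y ⬝ᵥ fun s ↦ tailProb Q.step (·.done.toNat) 0 s (s.i₁ + s.i₂) := by
  simp only [emptyMass, dotProduct, tailProb, Nat.add_eq_zero_iff, Fin.ext_iff,
    Fin.val_zero, mul_ite, mul_one, mul_zero]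

theorem emptyMass_xTilde {Q : Params m n₁ n₂ l} (hQ : Q.IsStochastic)
    (x : State m n₁ n₂ l N₁ N₂ → ℝ) (n : ℕ) :
    emptyMass (Q.xTilde x n) =
      Q.z x ⬝ᵥ fun s ↦ tailProb Q.step (·.done.toNat) n s (s.i₁ + s.i₂) := by
  rw [emptyMass_eq_dotProduct Q.noArrivals, xTilde_dotProduct_tailProb, Nat.zero_add]
  simp only [tailProb_noArrivals hQ n _ le_rfl]

end Tagged


section Positivity

variable {m n₁ n₂ l N₁ N₂ : ℕ} {Q : Params m n₁ n₂ l}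

theorem DPH.IsValid.exit_nonneg {n : ℕ} {F : DPH n} (hF : F.IsValid) (j : Fin n) : 0 ≤ F.exit j :=
  sub_nonneg.2 (hF.trans_sum j)

theorem start₁_nonneg (hQ : Q.IsValid) (full : Bool) (p : Option (Fin l ⊕ Fin n₁)) :
    0 ≤ Q.start₁ full p := by
  rcases p with _ | j | j <;> cases full <;>
    simp [Params.start₁, hQ.vac.init_nonneg, hQ.tx.init_nonneg]

theorem start₂_nonneg (hQ : Q.IsValid) (p : Option (Fin n₂)) : 0 ≤ Q.start₂ p := by
  rcases p with _ | j <;> simp [Params.start₂, hQ.comp.init_nonneg]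

theorem server₁_nonneg (hQ : Q.IsValid) (full : Bool) (p : Option (Fin l ⊕ Fin n₁)) (sent : Bool)
    (p' : Option (Fin l ⊕ Fin n₁)) : 0 ≤ Q.server₁ full p sent p' := by
  have hstart := start₁_nonneg hQ full
  have htx := hQ.tx.exit_nonneg
  have hvac := hQ.vac.exit_nonneg
  rcases p with _ | j | j <;> cases sent <;> rcases p' with _ | j' | j' <;>
    simp only [Params.server₁, le_refl, hstart, mul_nonneg, add_nonneg, htx, hvac,
      hQ.vac.trans_nonneg, hQ.tx.trans_nonneg]

theorem server₂_nonneg (hQ : Q.IsValid) (p : Option (Fin n₂)) (done : Bool)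
    (p' : Option (Fin n₂)) : 0 ≤ Q.server₂ p done p' := by
  have hstart := start₂_nonneg hQ
  have hcomp := hQ.comp.exit_nonneg
  rcases p with _ | j <;> cases done <;> rcases p' with _ | j' <;>
    simp only [Params.server₂, le_refl, hstart, mul_nonneg, hcomp, hQ.comp.trans_nonneg]

theorem step_nonneg (hQ : Q.IsValid) (s : State m n₁ n₂ l N₁ N₂) (e : Slot)
    (s' : State m n₁ n₂ l N₁ N₂) : 0 ≤ Q.step s e s' := by
  have harrival : 0 ≤ (if e.arrival then Q.D₁ else Q.D₀) s.ph s'.ph := by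
    split_ifs
    · exact hQ.dmap.nonneg₁ _ _
    · exact hQ.dmap.nonneg₀ _ _
  exact ite_nonneg (mul_nonneg (mul_nonneg harrival (server₁_nonneg hQ _ _ _ _))
    (server₂_nonneg hQ _ _ _)) le_rfl

theorem sum_step_p₂_of_not_done (hQ : Q.IsStochastic) {s : State m n₁ n₂ l N₁ N₂} {i : Fin n₂}
    (hi : s.p₂ = some i) (j : Fin n₂) :
    ∑ e, ∑ s', Q.step s e s' * (if e.done then 0 else if s'.p₂ = some j then 1 else 0) =
      Q.comp.trans i j := by
  have hempty (sent : Bool) : decide (next₂ s.i₂ sent false = 0) = false :=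
    decide_eq_false (next₂_ne_zero (State.p₂_ne_none_iff.1 (hi ▸ Option.some_ne_none i)) sent)
  have hslot (a b d : Bool) :
      ∑ s', Q.step s ⟨a, b, d⟩ s' * (if d then 0 else if s'.p₂ = some j then 1 else 0) =
        (∑ h, Q.arrivalProb a s.ph h) *
          (Q.sendProb s.p₁ b * if d then 0 else Q.comp.trans i j) := by
    rw [sum_step_mul_p₂ hQ s ⟨a, b, d⟩ fun p₂ ↦ if d then 0 else if p₂ = some j then 1 else 0]
    cases d <;> simp [hempty, hi, Params.kernel₂, Params.server₂]
  rw [sum_slot]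
  simp only [hslot]
  simp only [← Finset.mul_sum, hQ.sum_arrival_mul, ← Finset.sum_mul, sum_sendProb, one_mul]
  simp

/-- The phase transitions of a busy server 1 in the slots in which it completes no transmission,
while queue 2 is empty. -/
def Params.busyMatrix (Q : Params m n₁ n₂ l) : Matrix (Fin l ⊕ Fin n₁) (Fin l ⊕ Fin n₁) ℝ :=
  Matrix.of fun p p' ↦ Q.server₁ false (some p) false (some p')

theorem isUnit_one_sub_busyMatrix (hQ : Q.IsValid) : IsUnit (1 - Q.busyMatrix) := by
  have hblocks : 1 - Q.busyMatrix = Matrix.fromBlocks (1 - Q.vac.trans)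
      (-Matrix.of fun j j' ↦ Q.vac.exit j * Q.tx.init j') 0 (1 - Q.tx.trans) := by
    ext (i | i) (j | j) <;>
      simp [Params.busyMatrix, Params.server₁, Params.start₁, Matrix.one_apply]
  rw [hblocks, Matrix.isUnit_fromBlocks_zero₂₁]
  exact ⟨hQ.vac.nonsing, hQ.tx.nonsing⟩

theorem sum_step_p₁_of_not_sent (hQ : Q.IsStochastic) (hN₂ : 0 < N₂)
    {s : State m n₁ n₂ l N₁ N₂} (hs : s.p₂ = none) {i : Fin l ⊕ Fin n₁} (hi : s.p₁ = some i)
    (j : Fin l ⊕ Fin n₁) :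
    ∑ e, ∑ s', Q.step s e s' * (if e.sent then 0 else if s'.p₁ = some j then 1 else 0) =
      Q.busyMatrix i j := by
  have hfull (d : Bool) : decide (next₂ s.i₂ false d = N₂) = false := by
    rw [s.idle₂.1 hs]
    exact decide_eq_false ((Nat.sub_le _ _).trans_lt (by simpa using hN₂)).ne
  have hslot (a b d : Bool) :
      ∑ s', Q.step s ⟨a, b, d⟩ s' * (if b then 0 else if s'.p₁ = some j then 1 else 0) =
        (∑ h, Q.arrivalProb a s.ph h) *
          ((if b then 0 else Q.busyMatrix i j) * Q.doneProb s.p₂ d) := by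
    rw [sum_step_mul_p₁ hQ s ⟨a, b, d⟩ fun p₁ ↦ if b then 0 else if p₁ = some j then 1 else 0]
    cases b
    · have hbusy : decide (next₁ s ⟨a, false, d⟩ = 0) = false :=
        decide_eq_false (next₁_ne_zero (hi ▸ Option.some_ne_none i) rfl)
      simp [hbusy, hfull, hi, Params.kernel₁, Params.busyMatrix]
    · simp
  rw [sum_slot]
  simp only [hslot]
  simp only [← Finset.mul_sum, hQ.sum_arrival_mul, sum_doneProb, mul_one]
  simp

variable {x : State m n₁ n₂ l N₁ N₂ → ℝ}

theorem never_sent_of_never_enters (hQ : Q.IsValid) (hx : Q.IsStationary x)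
    (hin : Never Q.step x fun s e ↦ enters s e = true) :
    Never Q.step x fun _ e ↦ e.sent = true := by
  refine never_of_add_eq hx.stationary hx.nonneg (step_nonneg hQ) (sum_step hQ.isStochastic)
    (f := fun s ↦ s.i₁) fun s e s' hs he ↦ ?_
  rw [(isFeasible_of_step_ne_zero he).i₁_add, hin.eq_false hs he, Bool.toNat_false, Nat.add_zero]

theorem never_done_of_never_sent (hQ : Q.IsValid) (hx : Q.IsStationary x)
    (hsent : Never Q.step x fun _ e ↦ e.sent = true) :
    Never Q.step x fun _ e ↦ e.done = true := by
  refine never_of_add_eq hx.stationary hx.nonneg (step_nonneg hQ) (sum_step hQ.isStochastic)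
    (f := fun s ↦ s.i₂) fun s e s' hs he ↦ ?_
  rw [(isFeasible_of_step_ne_zero he).i₂_add, hsent.eq_false hs he, Bool.toNat_false, Nat.add_zero]

theorem p₂_eq_none_of_never_sent (hQ : Q.IsValid) (hx : Q.IsStationary x)
    (hsent : Never Q.step x fun _ e ↦ e.sent = true) {s : State m n₁ n₂ l N₁ N₂} (hs : x s ≠ 0) :
    s.p₂ = none := by
  have hdone := never_done_of_never_sent hQ hx hsent
  refine eq_none_of_isUnit_one_sub (κ := Q.step) hx.stationary hx.nonneg hQ.comp.nonsing
    (fun s hs j ↦ ?_) hs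
  rcases hi : s.p₂ with _ | i
  · refine Finset.sum_eq_zero fun e _ ↦ Finset.sum_eq_zero fun s' _ ↦ ?_
    by_cases he : Q.step s e s' = 0
    · rw [he, zero_mul]
    have hempty : s'.p₂ = none := by
      have hadd := (isFeasible_of_step_ne_zero he).i₂_add
      rw [hsent.eq_false hs he, hdone.eq_false hs he, s.idle₂.1 hi] at hadd
      exact s'.idle₂.2 (Fin.ext hadd)
    simp [hempty]
  · rw [Option.elim_some, ← sum_step_p₂_of_not_done hQ.isStochastic hi j]
    refine Finset.sum_congr rfl fun e _ ↦ Finset.sum_congr rfl fun s' _ ↦ ?_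
    by_cases he : Q.step s e s' = 0
    · simp only [he, zero_mul]
    · simp [hdone.eq_false hs he]

theorem p₁_eq_none_of_never_enters (hQ : Q.IsValid) (hN₂ : 0 < N₂) (hx : Q.IsStationary x)
    (hin : Never Q.step x fun s e ↦ enters s e = true) {s : State m n₁ n₂ l N₁ N₂}
    (hs : x s ≠ 0) : s.p₁ = none := by
  have hsent := never_sent_of_never_enters hQ hx hin
  refine eq_none_of_isUnit_one_sub (κ := Q.step) hx.stationary hx.nonneg
    (isUnit_one_sub_busyMatrix hQ) (fun s hs j ↦ ?_) hs
  rcases hi : s.p₁ with _ | i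
  · refine Finset.sum_eq_zero fun e _ ↦ Finset.sum_eq_zero fun s' _ ↦ ?_
    by_cases he : Q.step s e s' = 0
    · rw [he, zero_mul]
    have hempty : s'.p₁ = none := by
      have hadd := (isFeasible_of_step_ne_zero he).i₁_add
      rw [hsent.eq_false hs he, hin.eq_false hs he, s.idle₁.1 hi] at hadd
      exact s'.idle₁.2 (Fin.ext hadd)
    simp [hempty]
  · rw [Option.elim_some, ← sum_step_p₁_of_not_sent hQ.isStochastic hN₂
      (p₂_eq_none_of_never_sent hQ hx hsent hs) hi j]
    refine Finset.sum_congr rfl fun e _ ↦ Finset.sum_congr rfl fun s' _ ↦ ?_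
    by_cases he : Q.step s e s' = 0
    · simp only [he, zero_mul]
    · simp [hsent.eq_false hs he]

theorem phaseMass_ph_vecMul (hQ : Q.IsStochastic) (hx : Q.IsStationary x) :
    phaseMass x (some ∘ State.ph) ᵥ* (Q.D₀ + Q.D₁) = phaseMass x (some ∘ State.ph) := by
  refine phaseMass_vecMul (κ := Q.step) hx.stationary fun s _ j ↦ ?_
  have hsum := sum_step_arrival_ph hQ s fun _ h ↦ if h = j then 1 else 0
  simpa [Params.arrivalProb, add_comm] using hsum

theorem exists_D₁_ne_zero (hQ : Q.IsValid) (hx : Q.IsStationary x) :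
    ∃ s, x s ≠ 0 ∧ ∑ h, Q.D₁ s.ph h ≠ 0 := by
  by_contra! hrow
  have hmass (f : Fin m → ℝ) :
      ∑ j, phaseMass x (some ∘ State.ph) j * f j = ∑ s, x s * f s.ph :=
    sum_phaseMass_mul _ f
  have hpos := hQ.dmap.rate_pos (phaseMass x (some ∘ State.ph))
    (fun j ↦ Finset.sum_nonneg fun s _ ↦ ite_nonneg (hx.nonneg s) le_rfl)
    (by simpa only [mul_one, hx.sum_eq_one] using hmass fun _ ↦ 1)
    (phaseMass_ph_vecMul hQ.isStochastic hx)
  simp only [Matrix.vecMul, dotProduct] at hpos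
  rw [Finset.sum_comm] at hpos
  simp only [← Finset.mul_sum, hmass fun j ↦ ∑ h, Q.D₁ j h] at hpos
  refine hpos.ne' (Finset.sum_eq_zero fun s _ ↦ ?_)
  by_cases hs : x s = 0
  · rw [hs, zero_mul]
  · rw [hrow s hs, mul_zero]

theorem not_never_enters (hQ : Q.IsValid) (hN₁ : 0 < N₁) (hN₂ : 0 < N₂) (hx : Q.IsStationary x) :
    ¬Never Q.step x fun s e ↦ enters s e = true := by
  intro hin
  obtain ⟨s, hs, hrow⟩ := exists_D₁_ne_zero hQ hx
  have hempty : s.i₁ = 0 := s.idle₁.1 (p₁_eq_none_of_never_enters hQ hN₂ hx hin hs)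
  have hzero : ∑ e, ∑ s', Q.step s e s' * (if e.arrival then 1 else 0) = 0 := by
    refine Finset.sum_eq_zero fun e _ ↦ Finset.sum_eq_zero fun s' _ ↦ ?_
    cases ha : e.arrival
    · simp
    · rw [hin hs (by simp [enters, hempty, ha, hN₁]), zero_mul]
  rw [sum_step_arrival_ph hQ.isStochastic s fun a _ ↦ if a then 1 else 0] at hzero
  exact hrow (by simpa [Params.arrivalProb] using hzero)

theorem sum_vecMul_Phat_pos (hQ : Q.IsValid) (hN₁ : 0 < N₁) (hN₂ : 0 < N₂)
    (hx : Q.IsStationary x) : 0 < ∑ s, (x ᵥ* Q.Phat N₁ N₂) s := by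
  have hPhat (s s' : State m n₁ n₂ l N₁ N₂) (e : Slot) :
      0 ≤ if enters s e then Q.step s e s' else 0 := ite_nonneg (step_nonneg hQ s e s') le_rfl
  obtain ⟨s, e, s', hs, he, hstep⟩ : ∃ s e s', x s ≠ 0 ∧ enters s e ∧ Q.step s e s' ≠ 0 := by
    simpa [Never] using not_never_enters hQ hN₁ hN₂ hx
  have hterm (s s' : State m n₁ n₂ l N₁ N₂) : 0 ≤ x s * Q.Phat N₁ N₂ s s' :=
    mul_nonneg (hx.nonneg s) (Finset.sum_nonneg fun e _ ↦ hPhat s s' e)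
  refine Finset.sum_pos' (fun s' _ ↦ Finset.sum_nonneg fun s _ ↦ hterm s s')
    ⟨s', Finset.mem_univ _, Finset.sum_pos' (fun s _ ↦ hterm s s') ⟨s, Finset.mem_univ _, ?_⟩⟩
  refine mul_pos ((hx.nonneg s).lt_of_ne' hs)
    (Finset.sum_pos' (fun e _ ↦ hPhat s s' e) ⟨e, Finset.mem_univ _, ?_⟩)
  rw [if_pos he]
  exact (step_nonneg hQ s e s').lt_of_ne' hstep

end Positivity

section Delay

variable {m n₁ n₂ l N₁ N₂ : ℕ} {Q : Params m n₁ n₂ l} {x : State m n₁ n₂ l N₁ N₂ → ℝ}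
  {Ω : Type*} [MeasurableSpace Ω] {μ : Measure Ω} {X : ℕ → Ω → State m n₁ n₂ l N₁ N₂}
  {E : ℕ → Ω → Slot}

theorem Params.IsRealization.isMarkedChain (hXE : Q.IsRealization x μ X E) :
    IsMarkedChain x Q.step μ X E :=
  ⟨hXE.measurable_state, hXE.measurable_slot, hXE.law⟩

/-- The event that the computations completed in the `n` slots after slot `k` are at least as many
as the tasks in the system right after slot `k`. -/
def drainEvent (X : ℕ → Ω → State m n₁ n₂ l N₁ N₂) (E : ℕ → Ω → Slot) (k n : ℕ) : Set Ω :=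
  {ω | ((X (k + 1) ω).i₁ + (X (k + 1) ω).i₂ : ℕ) ≤
    ∑ i ∈ Finset.range n, (E (k + 1 + i) ω).done.toNat}

theorem delayProb_le_zero (μ : Measure Ω) (X : ℕ → Ω → State m n₁ n₂ l N₁ N₂)
    (E : ℕ → Ω → Slot) (k : ℕ) : delayProb μ X E k {t | t ≤ 0} = 0 := by
  have hempty : {ω | randomDelay X E k ω ∈ {t : ℕ∞ | t ≤ 0}} = ∅ := by
    refine Set.eq_empty_of_forall_notMem fun ω hω ↦ ?_
    obtain ⟨j, hj, -⟩ := (delay_le_iff_exists_completes _ _ k 0).1 hω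
    exact Nat.not_lt_zero j hj
  rw [delayProb, hempty, measureReal_empty]

theorem measurableSet_enterEvent (hXE : Q.IsRealization x μ X E) (k : ℕ) :
    MeasurableSet (enterEvent X E k) :=
  hXE.isMarkedChain.measurableSet_of_isDeterminedUpTo (j := k + 1) fun ω ω' hX hE hω ↦ by
    simpa only [enterEvent, Set.mem_ofPred_eq, hX k k.le_succ, hE k k.lt_succ_self] using hω

theorem measurableSet_drainEvent (hXE : Q.IsRealization x μ X E) (k n : ℕ) :
    MeasurableSet (drainEvent X E k n) :=
  hXE.isMarkedChain.measurableSet_of_isDeterminedUpTo (j := k + 1 + n) fun ω ω' hX hE hω ↦ by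
    have hdone : ∑ i ∈ Finset.range n, (E (k + 1 + i) ω).done.toNat =
        ∑ i ∈ Finset.range n, (E (k + 1 + i) ω').done.toNat :=
      Finset.sum_congr rfl fun i hi ↦ by
        rw [hE _ (Nat.add_lt_add_left (Finset.mem_range.1 hi) _)]
    simpa only [drainEvent, Set.mem_ofPred_eq, hX (k + 1) (Nat.le_add_right _ _), hdone] using hω

variable [IsFiniteMeasure μ]

theorem measureReal_enterEvent_inter_drainEvent (hx : Q.IsStationary x)
    (hXE : Q.IsRealization x μ X E) (k n : ℕ) :
    μ.real (enterEvent X E k ∩ drainEvent X E k n) =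
      (x ᵥ* Q.Phat N₁ N₂) ⬝ᵥ fun s ↦ tailProb Q.step (·.done.toNat) n s (s.i₁ + s.i₂) :=
  hXE.isMarkedChain.measureReal_step_inter_le_sum hx.stationary enters (·.done.toNat)
    (fun s ↦ s.i₁ + s.i₂) k n

theorem measureReal_enterEvent (hx : Q.IsStationary x) (hXE : Q.IsRealization x μ X E) (k : ℕ) :
    μ.real (enterEvent X E k) = ∑ s, (x ᵥ* Q.Phat N₁ N₂) s := by
  have h := hXE.isMarkedChain.measureReal_step_inter_le_sum hx.stationary enters (fun _ ↦ 0)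
    (fun _ ↦ 0) k 0
  simp only [zero_le, Set.ofPred_true, Set.inter_univ, tailProb, if_true, dotProduct, mul_one] at h
  exact h

theorem randomDelay_le_ae_eq_drainEvent (hXE : Q.IsRealization x μ X E) (k n : ℕ) :
    {ω | randomDelay X E k ω ≤ n} =ᵐ[ProbabilityTheory.cond μ (enterEvent X E k)]
      drainEvent X E k n := by
  have hstep := (ProbabilityTheory.cond_absolutelyContinuous (s := enterEvent X E k)).ae_le
    hXE.isMarkedChain.ae_ne_zero
  filter_upwards [hstep, ProbabilityTheory.ae_cond_mem (measurableSet_enterEvent hXE k)]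
    with ω hω hk
  exact propext (delay_le_iff (fun j ↦ isFeasible_of_step_ne_zero (hω j)) hk n)

theorem nullMeasurableSet_randomDelay_le (hXE : Q.IsRealization x μ X E) (k n : ℕ) :
    NullMeasurableSet {ω | randomDelay X E k ω ≤ n}
      (ProbabilityTheory.cond μ (enterEvent X E k)) :=
  (measurableSet_drainEvent hXE k n).nullMeasurableSet.congr
    (randomDelay_le_ae_eq_drainEvent hXE k n).symm

theorem delayProb_le (hQ : Q.IsValid) (hx : Q.IsStationary x) (hXE : Q.IsRealization x μ X E)
    (k n : ℕ) : delayProb μ X E k {t | t ≤ n} = emptyMass (Q.xTilde x n) := by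
  calc delayProb μ X E k {t | t ≤ n}
      = (ProbabilityTheory.cond μ (enterEvent X E k)).real (drainEvent X E k n) :=
        measureReal_congr (randomDelay_le_ae_eq_drainEvent hXE k n)
    _ = (μ.real (enterEvent X E k))⁻¹ * μ.real (enterEvent X E k ∩ drainEvent X E k n) := by
        simp only [measureReal_def, ProbabilityTheory.cond_apply (measurableSet_enterEvent hXE k),
          ENNReal.toReal_mul, ENNReal.toReal_inv]
    _ = Q.z x ⬝ᵥ fun s ↦ tailProb Q.step (·.done.toNat) n s (s.i₁ + s.i₂) := by
        rw [measureReal_enterEvent hx hXE, measureReal_enterEvent_inter_drainEvent hx hXE,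
          Params.z, smul_dotProduct, smul_eq_mul]
    _ = emptyMass (Q.xTilde x n) := (emptyMass_xTilde hQ.isStochastic x n).symm

theorem delayProb_eq (hXE : Q.IsRealization x μ X E) (k : ℕ) {n : ℕ} (hn : 1 ≤ n) :
    delayProb μ X E k {t | t = n} =
      delayProb μ X E k {t | t ≤ n} - delayProb μ X E k {t | t ≤ (n - 1 : ℕ)} := by
  obtain ⟨n, rfl⟩ := Nat.exists_eq_add_of_le' hn
  have heq : {ω | randomDelay X E k ω ≤ (n + 1 : ℕ)} \ {ω | randomDelay X E k ω ≤ n} =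
      {ω | randomDelay X E k ω = (n + 1 : ℕ)} := by
    ext ω
    rw [Set.mem_sdiff, Set.mem_ofPred_eq, Set.mem_ofPred_eq, Set.mem_ofPred_eq, not_le,
      Nat.cast_succ, ← ENat.add_one_le_iff (ENat.natCast_ne_top n), le_antisymm_iff]
  have hsub : {ω | randomDelay X E k ω ≤ n} ⊆ {ω | randomDelay X E k ω ≤ (n + 1 : ℕ)} :=
    Set.ofPred_subset_ofPred.2 fun _ hω ↦ hω.trans (Nat.cast_le.2 n.le_succ)
  have hsplit := measureReal_inter_add_sdiff₀ (s := {ω | randomDelay X E k ω ≤ (n + 1 : ℕ)})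
    (nullMeasurableSet_randomDelay_le hXE k n)
  rw [Set.inter_eq_right.2 hsub, heq] at hsplit
  exact eq_sub_of_add_eq' hsplit

theorem delayProb_gt (hXE : Q.IsRealization x μ X E) {k : ℕ} (hk : 0 < μ.real (enterEvent X E k))
    (n : ℕ) : delayProb μ X E k {t | t > n} = 1 - delayProb μ X E k {t | t ≤ n} := by
  have := ProbabilityTheory.cond_isProbabilityMeasure ((measureReal_ne_zero_iff).1 hk.ne')
  have hcompl : {ω | randomDelay X E k ω > n} = {ω | randomDelay X E k ω ≤ n}ᶜ := by
    ext ω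
    simp only [Set.mem_ofPred_eq, Set.mem_compl_iff, not_le, gt_iff_lt]
  exact (congrArg _ hcompl).trans
    (probReal_compl_eq_one_sub₀ (nullMeasurableSet_randomDelay_le hXE k n))

end Delay

end TandemQueue

open TandemQueue in
theorem proposition1_general {m n₁ n₂ l : ℕ} (Q : Params m n₁ n₂ l) (hQ : Q.IsValid)
    (N₁ N₂ : ℕ) (hN₁ : 0 < N₁) (hN₂ : 0 < N₂)
    (x : State m n₁ n₂ l N₁ N₂ → ℝ) (hx : Q.IsStationary x)
    {Ω : Type*} [MeasurableSpace Ω] (μ : MeasureTheory.Measure Ω)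
    [MeasureTheory.IsProbabilityMeasure μ]
    (X : ℕ → Ω → State m n₁ n₂ l N₁ N₂) (E : ℕ → Ω → Slot)
    (hXE : Q.IsRealization x μ X E) (k : ℕ) :
    0 < μ.real (enterEvent X E k) ∧
    delayProb μ X E k {t | t ≤ 0} = 0 ∧
    ∀ n : ℕ, 1 ≤ n →
      delayProb μ X E k {t | t ≤ n} = emptyMass (Q.xTilde x n) ∧
      delayProb μ X E k {t | t = n} =
        delayProb μ X E k {t | t ≤ n} - delayProb μ X E k {t | t ≤ (n - 1 : ℕ)} ∧
      delayProb μ X E k {t | t > n} = 1 - delayProb μ X E k {t | t ≤ n} := by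
  have hpos : 0 < μ.real (enterEvent X E k) := by
    rw [measureReal_enterEvent hx hXE]
    exact sum_vecMul_Phat_pos hQ hN₁ hN₂ hx
  exact ⟨hpos, delayProb_le_zero μ X E k, fun n hn ↦
    ⟨delayProb_le hQ hx hXE k n, delayProb_eq hXE k hn, delayProb_gt hXE hpos n⟩⟩

open TandemQueue in
theorem proposition1 {m n₁ n₂ l : ℕ} (Q : Params m n₁ n₂ l) (hQ : Q.IsValid)
    (N₁ N₂ : ℕ) (hN₁ : 1 ≤ N₁) (hN₂ : N₁ < N₂)
    (x : State m n₁ n₂ l N₁ N₂ → ℝ) (hx : Q.IsStationary x)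
    {Ω : Type*} [MeasurableSpace Ω] (μ : MeasureTheory.Measure Ω)
    [MeasureTheory.IsProbabilityMeasure μ]
    (X : ℕ → Ω → State m n₁ n₂ l N₁ N₂) (E : ℕ → Ω → Slot)
    (hXE : Q.IsRealization x μ X E) (k : ℕ) :
    0 < μ.real (enterEvent X E k) ∧
    delayProb μ X E k {t | t ≤ 0} = 0 ∧
    ∀ n : ℕ, 1 ≤ n →
      delayProb μ X E k {t | t ≤ n} = emptyMass (Q.xTilde x n) ∧
      delayProb μ X E k {t | t = n} =
        delayProb μ X E k {t | t ≤ n} - delayProb μ X E k {t | t ≤ (n - 1 : ℕ)} ∧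
      delayProb μ X E k {t | t > n} = 1 - delayProb μ X E k {t | t ≤ n} :=
  proposition1_general Q hQ N₁ N₂ hN₁ (Nat.zero_lt_of_lt hN₂) x hx μ X E hXE k
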